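/- Theorem (Biased Maker-Breaker Hamiltonicity game). For every real $\alpha>0$ there exist constants $c,C>0$, depending only on $\alpha$, such that the following holds. For every $n\in\mathbb N$ let $G_\alpha$ be a graph on $n$ vertices with minimum degree $\delta(G_\alpha)\ge \alpha n$, let $b$ be an integer with $1\le b\le \frac{cn}{\ln n}$, and let $\frac{Cb}{n}\le p\le 1$ (where $G_\alpha$, $b$ and $p$ may all depend on $n$). Let $G_{n,p}$ be the binomial random graph on the vertex set of $G_\alpha$, in which every pair of distinct vertices forms an edge with probability $p$, independently of all other pairs. Then, with probability tending to $1$ as $n\to\infty$, Maker has a winning strategy in the $(1:b)$ Maker-Breaker Hamiltonicity game on $G_\alpha\cup G_{n,p}$, no matter which player starts. The convergence is uniform in the choice of $G_\alpha$, $b$ and $p$: for every $\varepsilon>0$ there is an $n_0$ such that for all $n\ge n_0$ and all $G_\alpha,b,p$ as above this probability is at least $1-\varepsilon$. Here, the $(1:b)$ Maker-Breaker Hamiltonicity game on a graph $G$ is the following game: the two players alternately claim previously unclaimed edges of $G$, Maker one edge in each of her turns and Breaker $b$ edges in each of his turns (all remaining edges if fewer than $b$ are left); Maker wins if at some point the edges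 she has claimed include all edges of a Hamilton cycle of $G$, and otherwise Breaker wins. -/

import Mathlib

/-- The two players of a Maker-Breaker game. -/
inductive MBPlayer where
  | maker
  | breaker

/-- `MakerWinsFrom b 𝓕 P U M` says that Maker has a winning strategy in the `(1 : b)`
Maker-Breaker game with family of winning sets `𝓕`, from the position in which it is the turn of
the player `P`, the set of unclaimed elements is `U`, and Maker has claimed the set `M` so far.
(All other elements of the board belong to Breaker.)

The game is finite, so winning strategies are given by backward induction; a derivation of
`MakerWinsFrom` is precisely a strategy tree for Maker, all of whose branches end in a position
where Maker has fully claimed a winning set. -/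
inductive MakerWinsFrom {X : Type*} [DecidableEq X] (b : ℕ) (𝓕 : Set (Finset X)) :
    MBPlayer → Finset X → Finset X → Prop where
  /-- Maker has already fully claimed a winning set. -/
  | claimed (P : MBPlayer) (U M F : Finset X) (hF : F ∈ 𝓕) (hFM : F ⊆ M) :
      MakerWinsFrom b 𝓕 P U M
  /-- On her turn, Maker chooses one unclaimed element `x` and claims it. -/
  | makerMove (U M : Finset X) (x : X) (hx : x ∈ U)
      (h : MakerWinsFrom b 𝓕 MBPlayer.breaker (U.erase x) (insert x M)) :
      MakerWinsFrom b 𝓕 MBPlayer.maker U M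
  /-- On his turn, Breaker claims `b` unclaimed elements (all of them if fewer than `b` are left),
  and Maker has to be able to answer every such choice `S`. -/
  | breakerMove (U M : Finset X)
      (h : ∀ S : Finset X, S ⊆ U → S.card = min b U.card →
        MakerWinsFrom b 𝓕 MBPlayer.maker (U \ S) M) :
      MakerWinsFrom b 𝓕 MBPlayer.breaker U M

/-- Maker has a winning strategy in the `(1 : b)` Maker-Breaker game on the hypergraph `(X, 𝓕)`
with finite vertex set (board) `X`, where the player `first` makes the first move. -/
def MakerWinsGame {X : Type*} [DecidableEq X] (b : ℕ) (board : Finset X) (𝓕 : Set (Finset X))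
    (first : MBPlayer) : Prop :=
  MakerWinsFrom b 𝓕 first board ∅

/-- The edge sets of the Hamilton cycles of `G`. -/
def hamiltonCycleEdgeSets {V : Type*} [DecidableEq V] (G : SimpleGraph V) :
    Set (Finset (Sym2 V)) :=
  {F | ∃ (v : V) (w : G.Walk v v), w.IsHamiltonianCycle ∧ F = w.edges.toFinset}

/-- Maker has a winning strategy in the `(1 : b)` Maker-Breaker Hamiltonicity game on (the edges
of) the finite graph `G`, no matter which of the two players makes the first move. -/
def MakerWinsHamiltonicity {V : Type*} [Finite V] [DecidableEq V] (b : ℕ) (G : SimpleGraph V) :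
    Prop :=
  ∀ first : MBPlayer,
    MakerWinsGame b (Set.toFinite G.edgeSet).toFinset (hamiltonCycleEdgeSets G) first

/-!
The proof reduces the random game to a deterministic criterion, which a random graph satisfies with
overwhelming probability.

*Expanders and boosters.* In a graph in which every set of at most `k` vertices has more than twice
as many outer neighbours, Pósa rotations turn a longest path into paths with more than `k` different
ends, for each of which there are more than `k` possible other ends. Joining the two ends, or an end
to a vertex off the path, creates a Hamilton cycle or a longer path
(`sq_le_two_mul_card_boosters`). So there are at least `(k + 1) ^ 2 / 2` such *boosters*, and after
at most `n` boosters the graph is Hamiltonian.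

*Maker's strategy.* Maker first claims six edges `s(v, f (v, i))` of `Gα` at every vertex `v`. She
always serves the vertex which is most endangered by Breaker's edges; as `b ≤ c n / log n`, a
potential argument shows that linearly many end points `f (v, i)` remain admissible all the time.
Among these she chooses by the method of conditional expectations, that is, she imitates a random
choice of `f` in which each value has probability at most `1 / d`, with `d` linear in `n`
(`makerWinsFrom_of_eventWeight`). This avoids all bad events as soon as their expected number is
below `1`: that some small set fails to expand, and that `f` is one of the functions that are bad
for the random graph `R` because boosters are rare in `R` for some completion of the edges of `f`
by edges of `R` (`IsBad`). Then she claims a booster in `R` in every further move; since only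
`O(b n)` edges are ever claimed, one is always left
(`makerWinsFrom_of_boosters`, `makerWinsHamiltonicity_of_sum_lt`).

*The random graph.* There are `n ^ (6 n)` functions `f`, far too many for a union bound over all of
them against failure probabilities of order `exp (-C b n)`. But each enters with the weight
`(1 / d) ^ (6 n)` only, so that the total weight of all `f` is exponential in `n`. For fixed `f` the
completions by a set `E'` of at most `n` random edges are compensated by the probability `p ^ #E'`
that these edges are present (`real_isBad_le`). Hence the expected weight of the bad `f` is
exponentially small if `C` is large, and Markov's inequality finishes the proof.
-/

namespace MBHam
open Finset SimpleGraph

/-! ### Rotations of paths -/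

section Rotation
variable {V : Type*}

/-- A path of `H`, encoded as the list of its vertices. -/
def IsPathList (H : SimpleGraph V) (l : List V) : Prop := l.IsChain H.Adj ∧ l.Nodup

/-- `x` and `y` stand next to each other in `l`, in either order. This is expressed by the failure of
a chain condition, for which the lemmas on reversed and concatenated lists are available. -/
def Consec (l : List V) (x y : V) : Prop := ¬ l.IsChain fun a b => s(a, b) ≠ s(x, y)

lemma consec_comm {l : List V} {x y : V} : Consec l x y ↔ Consec l y x := by
  unfold Consec
  rw [Sym2.eq_swap]

lemma consec_cons_cons {l : List V} {a b x y : V} :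
    Consec (a :: b :: l) x y ↔ s(a, b) = s(x, y) ∨ Consec (b :: l) x y := by
  unfold Consec
  rw [List.isChain_cons_cons]
  tauto

lemma not_consec_singleton {a x y : V} : ¬ Consec [a] x y := by
  simp [Consec]

lemma consec_append_cons_cons (l : List V) (a b : V) (l' : List V) :
    Consec (l ++ a :: b :: l') a b := by
  unfold Consec
  rw [List.isChain_append]
  simp

lemma Consec.mem {l : List V} {x y : V} (h : Consec l x y) : x ∈ l := by
  by_contra hx
  apply h
  induction l with
  | nil => simp
  | cons a l ih =>
    cases l with
    | nil => simp
    | cons b l =>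
      simp only [List.mem_cons, not_or] at hx
      rw [List.isChain_cons_cons]
      have hab : s(a, b) ≠ s(x, y) := by grind [Sym2.eq_iff]
      refine ⟨hab, ih ?_ (by simp; tauto)⟩
      rw [consec_cons_cons] at h
      tauto

lemma isChain_ne_reverse {l : List V} {x y : V} :
    (l.reverse.IsChain fun a b => s(a, b) ≠ s(x, y)) ↔ l.IsChain fun a b => s(a, b) ≠ s(x, y) := by
  rw [List.isChain_reverse]
  have : (fun a b : V => s(b, a) ≠ s(x, y)) = fun a b => s(a, b) ≠ s(x, y) := by
    funext a b; rw [Sym2.eq_swap]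
  rw [this]

/-- Reversing the initial segment `q` of a path changes only the pair in which `q` meets the
rest of the path. -/
lemma Consec.of_rotate {q l : List V} {z u x y : V} (hu : q.head? = some u)
    (h : Consec (q.reverse ++ z :: l) x y) :
    Consec (q ++ z :: l) x y ∨ s(u, z) = s(x, y) := by
  unfold Consec at *
  by_contra hc
  push Not at hc
  apply h
  rw [List.isChain_append, isChain_ne_reverse]
  obtain ⟨h1, h2⟩ := hc
  rw [List.isChain_append] at h1
  refine ⟨h1.1, h1.2.1, ?_⟩
  intro a ha b hb
  simp only [List.getLast?_reverse, hu, Option.mem_def, Option.some.injEq] at ha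
  simp only [List.head?_cons, Option.mem_def, Option.some.injEq] at hb
  subst ha hb
  exact h2

lemma consec_finite {l : List V} (hl : l.Nodup) (x : V) :
    ∃ a b : V, ∀ y, Consec l x y → y = a ∨ y = b := by
  induction l with
  | nil => exact ⟨x, x, fun y h => absurd h.mem (by simp)⟩
  | cons c l ih =>
    cases l with
    | nil => exact ⟨x, x, fun y h => absurd h not_consec_singleton⟩
    | cons d l =>
      obtain ⟨hc, hl'⟩ := List.nodup_cons.1 hl
      by_cases hxc : x = c
      · refine ⟨d, d, fun y h => ?_⟩
        rw [consec_cons_cons] at h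
        rcases h with h | h
        · grind [Sym2.eq_iff]
        · exact absurd h.mem (hxc ▸ hc)
      by_cases hxd : x = d
      · subst hxd
        cases l with
        | nil =>
          refine ⟨c, c, fun y h => ?_⟩
          rw [consec_cons_cons] at h
          rcases h with h | h
          · grind [Sym2.eq_iff]
          · exact absurd h not_consec_singleton
        | cons e l =>
          refine ⟨c, e, fun y h => ?_⟩
          rw [consec_cons_cons, consec_cons_cons] at h
          obtain ⟨hd, -⟩ := List.nodup_cons.1 hl'
          rcases h with h | h | h
          · grind [Sym2.eq_iff]
          · grind [Sym2.eq_iff]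
          · exact absurd h.mem hd
      · obtain ⟨a, b, hab⟩ := ih hl'
        refine ⟨a, b, fun y h => ?_⟩
        rw [consec_cons_cons] at h
        rcases h with h | h
        · grind [Sym2.eq_iff]
        · exact hab y h

/-- `Q'` arises from the path `Q` by a Pósa rotation: the first vertex `u` of `Q` has a neighbour
`z` on `Q`, and the part of `Q` in front of `z` is reversed. -/
def Rotates (H : SimpleGraph V) (Q Q' : List V) : Prop :=
  ∃ q z l u, Q = q ++ z :: l ∧ q.head? = some u ∧ H.Adj u z ∧ Q' = q.reverse ++ z :: l

variable {H : SimpleGraph V}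

lemma Rotates.isPathList {Q Q' : List V} (h : Rotates H Q Q') (hQ : IsPathList H Q) :
    IsPathList H Q' := by
  obtain ⟨q, z, l, u, rfl, hu, huz, rfl⟩ := h
  obtain ⟨hc, hn⟩ := hQ
  refine ⟨?_, ?_⟩
  · rw [List.isChain_append] at hc ⊢
    refine ⟨?_, hc.2.1, ?_⟩
    · rw [List.isChain_reverse]
      exact hc.1.imp fun a b hab => hab.symm
    · intro a ha b hb
      simp only [List.getLast?_reverse, hu, Option.mem_def, Option.some.injEq] at ha
      simp only [List.head?_cons, Option.mem_def, Option.some.injEq] at hb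
      subst ha hb
      exact huz
  · exact (((List.reverse_perm q).append_right _).nodup_iff).2 hn

lemma Rotates.perm {Q Q' : List V} (h : Rotates H Q Q') : Q'.Perm Q := by
  obtain ⟨q, z, l, u, rfl, -, -, rfl⟩ := h
  exact (List.reverse_perm q).append_right _

lemma Rotates.getLast? {Q Q' : List V} (h : Rotates H Q Q') : Q'.getLast? = Q.getLast? := by
  obtain ⟨q, z, l, u, rfl, -, -, rfl⟩ := h
  simp [List.getLast?_append, List.getLast?_cons]

/-- Reachability by a sequence of rotations. -/
def Reaches (H : SimpleGraph V) : List V → List V → Prop := Relation.ReflTransGen (Rotates H)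

lemma Reaches.spec {P Q : List V} (h : Reaches H P Q) (hP : IsPathList H P) :
    IsPathList H Q ∧ Q.Perm P ∧ Q.getLast? = P.getLast? := by
  induction h with
  | refl => exact ⟨hP, .refl _, rfl⟩
  | tail _ h ih =>
    exact ⟨h.isPathList ih.1, h.perm.trans ih.2.1, h.getLast?.trans ih.2.2⟩

/-- The vertices that become the first vertex of a path obtained from `P` by rotations. -/
def rotationEnds (H : SimpleGraph V) (P : List V) : Set V :=
  {u | ∃ Q, Reaches H P Q ∧ Q.head? = some u}

/-- A vertex which is no rotation end, and has no rotation end next to it on `P`, keeps its two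
path neighbours under all rotations. -/
lemma Reaches.consec_iff {P Q : List V} (h : Reaches H P Q) {x : V} (hx : x ∉ rotationEnds H P)
    (hx' : ∀ y ∈ rotationEnds H P, ¬ Consec P x y) (y : V) : Consec Q x y ↔ Consec P x y := by
  induction h generalizing y with
  | refl => rfl
  | @tail Q Q' hPQ hr ih =>
    have hPQ' : Reaches H P Q' := Relation.ReflTransGen.tail hPQ hr
    obtain ⟨q, z, l, u, rfl, hu, huz, rfl⟩ := hr
    have huS : u ∈ rotationEnds H P := ⟨_, hPQ, by cases q <;> simp_all⟩
    obtain ⟨q', t, rfl⟩ : ∃ q' t, q = q' ++ [t] :=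
      ⟨q.dropLast, q.getLast (by rintro rfl; simp at hu), (List.dropLast_append_getLast _).symm⟩
    have htS : t ∈ rotationEnds H P := ⟨_, hPQ', by simp⟩
    have htz : Consec ((q' ++ [t]) ++ z :: l) t z := by
      simpa using consec_append_cons_cons q' t z l
    have hxz : x ≠ z := by
      rintro rfl
      exact hx' t htS ((ih t).1 (consec_comm.1 htz))
    have hxu : x ≠ u := fun h => hx (h ▸ huS)
    have hxt : x ≠ t := fun h => hx (h ▸ htS)
    rw [← ih y]
    constructor
    · intro h
      rcases h.of_rotate hu with h | h
      · exact h
      · grind [Sym2.eq_iff]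
    · intro h
      have := Consec.of_rotate (q := (q' ++ [t]).reverse) (u := t) (z := z) (l := l) (x := x)
        (y := y) (by simp) (by simpa using h)
      rcases this with h | h
      · exact h
      · grind [Sym2.eq_iff]

/-- Pósa's lemma. If no rotation of `P` can be extended at its first vertex, then every neighbour
of a rotation end is a rotation end itself or stands next to one on `P`. -/
lemma exists_consec_of_adj {P : List V}
    (hmax : ∀ Q, Reaches H P Q → ∀ u, Q.head? = some u → ∀ z, H.Adj u z → z ∈ Q)
    {u z : V} (hu : u ∈ rotationEnds H P) (hz : z ∉ rotationEnds H P) (huz : H.Adj u z) :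
    ∃ s ∈ rotationEnds H P, Consec P s z := by
  by_contra! hc
  obtain ⟨Q, hPQ, hQ⟩ := hu
  obtain ⟨q, l, rfl⟩ := List.append_of_mem (hmax Q hPQ u hQ z huz)
  have hq : q.head? = some u := by
    cases q with
    | nil => simp at hQ; exact absurd huz (hQ ▸ H.irrefl)
    | cons a q => simpa using hQ
  have hr : Rotates H (q ++ z :: l) (q.reverse ++ z :: l) := ⟨q, z, l, u, rfl, hq, huz, rfl⟩
  obtain ⟨q', t, rfl⟩ : ∃ q' t, q = q' ++ [t] :=
    ⟨q.dropLast, q.getLast (by rintro rfl; simp at hq), (List.dropLast_append_getLast _).symm⟩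
  have htS : t ∈ rotationEnds H P := ⟨_, Relation.ReflTransGen.tail hPQ hr, by simp⟩
  have htz : Consec ((q' ++ [t]) ++ z :: l) t z := by
    simpa using consec_append_cons_cons q' t z l
  refine hc t htS (consec_comm.1 ?_)
  exact (hPQ.consec_iff hz (fun y hy h => hc y hy (consec_comm.1 h)) t).1 (consec_comm.1 htz)

end Rotation

/-! ### Expanders and boosters -/

section Boosters
variable {V : Type*}

/-- Every nonempty set of at most `k` vertices has more than twice as many outer neighbours. -/
def Expands (H : SimpleGraph V) (k : ℕ) : Prop :=
  ∀ A : Finset V, A.Nonempty → #A ≤ k →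
    ∃ N : Finset V, (∀ w ∈ N, w ∉ A ∧ ∃ v ∈ A, H.Adj v w) ∧ 2 * #A < #N

variable {H H' : SimpleGraph V}

lemma IsPathList.reverse {l : List V} (h : IsPathList H l) : IsPathList H l.reverse := by
  refine ⟨?_, List.nodup_reverse.2 h.2⟩
  rw [List.isChain_reverse]
  exact h.1.imp fun a b hab => hab.symm

lemma IsPathList.mono {l : List V} (h : IsPathList H l) (hle : H ≤ H') : IsPathList H' l :=
  ⟨h.1.imp fun _ _ hab => hle hab, h.2⟩

lemma IsPathList.cons {l : List V} {u w : V} (h : IsPathList H l) (hu : l.head? = some u)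
    (hw : w ∉ l) (huw : H.Adj w u) : IsPathList H (w :: l) := by
  refine ⟨?_, List.nodup_cons.2 ⟨hw, h.2⟩⟩
  rw [List.isChain_cons]
  refine ⟨?_, h.1⟩
  intro y hy
  rw [hu] at hy
  obtain rfl : u = y := by simpa using hy
  exact huw

lemma IsPathList.length_le [Fintype V] {l : List V} (h : IsPathList H l) :
    l.length ≤ Fintype.card V := h.2.length_le_card

/-- A path which misses the vertex `w`, but contains a neighbour of `w`, becomes longer once its
ends are joined. -/
lemma IsPathList.exists_longer {l : List V} {t s x w : V} (h : IsPathList H l)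
    (ht : l.head? = some t) (hs : l.getLast? = some s) (hst : H.Adj s t) (hx : x ∈ l)
    (hw : w ∉ l) (hxw : H.Adj w x) : ∃ l', IsPathList H l' ∧ l.length < l'.length := by
  obtain ⟨l₁, l₂, rfl⟩ := List.append_of_mem hx
  refine ⟨w :: (x :: l₂ ++ l₁), ?_, by simp; omega⟩
  obtain ⟨hc, hn⟩ := h
  rw [List.isChain_append] at hc
  refine IsPathList.cons (u := x) ⟨?_, ?_⟩ (by simp) (by simp_all) hxw
  · rw [List.isChain_append]
    refine ⟨hc.2.1, hc.1, ?_⟩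
    intro a ha b hb
    have e1 : a = s := by
      have : (l₁ ++ x :: l₂).getLast? = (x :: l₂).getLast? := by
        simp [List.getLast?_append, List.getLast?_cons]
      rw [this, Option.mem_def.1 ha] at hs
      simpa using hs
    have e2 : b = t := by
      cases l₁ with
      | nil => simp at hb
      | cons c l₁ => simp_all
    subst e1 e2
    exact hst
  · exact (List.perm_append_comm.nodup_iff).2 hn

/-- A path through all of the at least three vertices whose ends are adjacent closes to a Hamilton
cycle. -/
lemma IsPathList.isHamiltonian [Fintype V] [DecidableEq V] {l : List V} {t s : V}
    (h : IsPathList H l) (hall : ∀ v, v ∈ l) (ht : l.head? = some t) (hs : l.getLast? = some s)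
    (hst : H.Adj s t) (h3 : 3 ≤ Fintype.card V) : H.IsHamiltonian := by
  have hlen : l.length = Fintype.card V := by
    classical
    rw [← List.toFinset_card_of_nodup h.2, ← Finset.card_univ]
    congr 1
    ext v
    simp [hall]
  match l, h, hall, ht, hs, hlen with
  | [], _, _, ht, _, _ => simp at ht
  | [_], _, _, _, _, hlen => simp at hlen; omega
  | [_, _], _, _, _, _, hlen => simp at hlen; omega
  | a :: b :: c :: l, h, hall, ht, hs, hlen =>
    obtain rfl : a = t := by simpa using ht
    obtain ⟨hc, hn⟩ := h
    have hs' : (b :: c :: l).getLast (by simp) = s := by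
      rw [List.getLast?_eq_some_getLast (by simp)] at hs
      simpa using hs
    have hab : H.Adj a b := hc.rel
    obtain ⟨p, hp, hplen⟩ : ∃ p : H.Walk b s, p.support = b :: c :: l ∧ p.length = l.length + 1 :=
      ⟨(Walk.ofSupport (b :: c :: l) (by simp) hc.of_cons).copy rfl hs',
        (Walk.support_copy _ _ _).trans (Walk.support_ofSupport _ _),
        (Walk.length_copy _ _ _).trans (Walk.length_ofSupport _ _)⟩
    refine fun _ => ⟨_, Walk.cons hst (Walk.cons hab p), ?_⟩
    rw [Walk.isHamiltonianCycle_iff_isCycle_and_length_eq]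
    constructor
    · rw [Walk.cons_isCycle_iff]
      constructor
      · rw [Walk.isPath_def, Walk.support_cons, hp]
        exact hn
      · rw [Walk.edges_cons, List.mem_cons]
        obtain ⟨ha, hn'⟩ := List.nodup_cons.1 hn
        rintro (h | h)
        · apply (List.nodup_cons.1 hn').1
          obtain rfl : s = b := by
            rw [Sym2.eq_swap] at h
            exact Sym2.congr_right.1 h
          rw [List.getLast_cons (by simp)] at hs'
          rw [← hs']
          exact List.getLast_mem _
        · apply ha
          rw [← hp]
          exact Walk.snd_mem_support_of_mem_edges _ h
    · simp only [Walk.length_cons, hplen]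
      simp only [List.length_cons] at hlen
      omega

/-- `e` is a booster of `H`: joining it to `H` creates a Hamilton cycle or a path longer than all
paths of `H`. -/
def IsBooster [Fintype V] [DecidableEq V] (H : SimpleGraph V) (e : Sym2 V) : Prop :=
  (H ⊔ fromEdgeSet {e}).IsHamiltonian ∨
    ∃ l', IsPathList (H ⊔ fromEdgeSet {e}) l' ∧ ∀ l, IsPathList H l → l.length < l'.length

lemma exists_longest [Fintype V] (H : SimpleGraph V) :
    ∃ P, IsPathList H P ∧ ∀ l, IsPathList H l → l.length ≤ P.length := by
  classical
  have hne : ∃ m, ∃ l, IsPathList H l ∧ l.length = m := ⟨0, [], ⟨by simp, by simp⟩, rfl⟩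
  have hb : ∀ m, (∃ l, IsPathList H l ∧ l.length = m) → m ≤ Fintype.card V := by
    rintro m ⟨l, hl, rfl⟩
    exact hl.length_le
  obtain ⟨P, hP, hlen⟩ := Nat.findGreatest_spec (P := fun m => ∃ l, IsPathList H l ∧ l.length = m)
    (hb _ hne.choose_spec) hne.choose_spec
  refine ⟨P, hP, fun l hl => ?_⟩
  rw [hlen]
  exact Nat.le_findGreatest (hb _ ⟨l, hl, rfl⟩) ⟨l, hl, rfl⟩

/-- A booster of a non-Hamiltonian graph is not an edge of it, nor a loop. -/
lemma IsBooster.notMem [Fintype V] [DecidableEq V] {e : Sym2 V} (h : IsBooster H e)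
    (hH : ¬ H.IsHamiltonian) : e ∉ H.edgeSet ∧ ¬ e.IsDiag := by
  by_contra hc
  have hle : H ⊔ fromEdgeSet {e} = H := by
    rw [sup_eq_left, ← edgeSet_subset_edgeSet, edgeSet_fromEdgeSet]
    rintro e' ⟨he', hd⟩
    obtain rfl : e' = e := by simpa using he'
    by_contra h'
    exact hc ⟨h', by simpa using hd⟩
  unfold IsBooster at h
  rw [hle] at h
  rcases h with h | ⟨l', hl', h⟩
  · exact hH h
  · exact lt_irrefl _ (h l' hl')

/-- The rotation ends of a path that cannot be extended form a set beyond the reach of the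
expansion. -/
lemma lt_ncard_rotationEnds [Fintype V] {k : ℕ} (hexp : Expands H k) {P : List V}
    (hP : IsPathList H P) (hne : P ≠ [])
    (hmax : ∀ Q, Reaches H P Q → ∀ u, Q.head? = some u → ∀ z, H.Adj u z → z ∈ Q) :
    ∃ S : Finset V, (∀ u ∈ S, u ∈ rotationEnds H P) ∧ k < #S := by
  classical
  let S : Finset V := univ.filter (· ∈ rotationEnds H P)
  have hmem : ∀ u, u ∈ S ↔ u ∈ rotationEnds H P := by simp [S]
  refine ⟨S, fun u hu => (hmem u).1 hu, ?_⟩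
  by_contra! hk
  have hSne : S.Nonempty := ⟨P.head hne, (hmem _).2 ⟨P, .refl, List.head?_eq_some_head hne⟩⟩
  obtain ⟨N, hN, hcard⟩ := hexp S hSne hk
  choose a b hab using consec_finite hP.2
  have hsub : N ⊆ S.image a ∪ S.image b := by
    intro w hw
    obtain ⟨hwS, v, hv, hvw⟩ := hN w hw
    obtain ⟨s, hs, hsw⟩ := exists_consec_of_adj hmax ((hmem v).1 hv) (fun h => hwS ((hmem w).2 h))
      hvw
    rw [mem_union, mem_image, mem_image]
    rcases hab s w hsw with rfl | rfl
    · exact Or.inl ⟨s, (hmem s).2 hs, rfl⟩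
    · exact Or.inr ⟨s, (hmem s).2 hs, rfl⟩
  have h1 := card_le_card hsub
  have h2 := card_union_le (S.image a) (S.image b)
  have h3 := card_image_le (s := S) (f := a)
  have h4 := card_image_le (s := S) (f := b)
  omega

/-- A family of unordered pairs containing, for each of `m` vertices, `m` pairs through it, has at
least `m ^ 2 / 2` members. -/
lemma sq_le_two_mul_card [DecidableEq V] {m : ℕ} {B : Finset (Sym2 V)} {S : Finset V}
    (hS : m ≤ #S) (T : V → Finset V) (hT : ∀ s ∈ S, m ≤ #(T s))
    (hB : ∀ s ∈ S, ∀ t ∈ T s, s(s, t) ∈ B) : m ^ 2 ≤ 2 * #B := by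
  have h1 : m ^ 2 ≤ #(S.sigma T) := by
    rw [card_sigma, sq]
    calc m * m ≤ #S * m := by gcongr
      _ = ∑ s ∈ S, m := by simp
      _ ≤ _ := sum_le_sum hT
  have h2 : #(S.sigma T) ≤ 2 * #B := by
    refine card_le_mul_card_image_of_maps_to (f := fun x : (_ : V) × V => s(x.1, x.2))
      (fun x hx => ?_) 2 fun e _ => ?_
    · rw [mem_sigma] at hx
      exact hB _ hx.1 _ hx.2
    · induction e with | _ a b =>
      refine (card_le_card (t := {⟨a, b⟩, ⟨b, a⟩}) ?_).trans card_le_two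
      rintro ⟨x, y⟩ hxy
      rw [mem_filter] at hxy
      have := hxy.2
      simp only [Sym2.eq_iff] at this
      rcases this with ⟨rfl, rfl⟩ | ⟨rfl, rfl⟩ <;> simp
  omega

/-- A graph in which all sets of at most `k` vertices expand has quadratically many boosters. -/
theorem sq_le_two_mul_card_boosters [Fintype V] [DecidableEq V] {k : ℕ} (hk : 1 ≤ k)
    (hV : 3 ≤ Fintype.card V) (hexp : Expands H k)
    {B : Finset (Sym2 V)} (hB : ∀ e, IsBooster H e → e ∈ B) : (k + 1) ^ 2 ≤ 2 * #B := by
  obtain ⟨P, hP, hlong⟩ := exists_longest H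
  -- Neighbours of an end of a longest path lie on the path.
  have hext : ∀ Q, IsPathList H Q → Q.length = P.length → ∀ u, Q.head? = some u →
      ∀ z, H.Adj u z → z ∈ Q := by
    intro Q hQ hlen u hu z huz
    by_contra hz
    have := hlong _ (hQ.cons hu hz huz.symm)
    simp at this
    omega
  have hlen1 : 1 ≤ P.length := by
    obtain ⟨v⟩ : Nonempty V := Fintype.card_pos_iff.1 (by omega)
    simpa using hlong [v] ⟨by simp, by simp⟩
  have hne : P ≠ [] := by rintro rfl; simp at hlen1
  -- The rotation ends of any longest path.
  have hrot : ∀ P', IsPathList H P' → P'.length = P.length →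
      ∃ S : Finset V, k + 1 ≤ #S ∧ ∀ u ∈ S, ∃ Q, IsPathList H Q ∧ Q.Perm P' ∧
        Q.getLast? = P'.getLast? ∧ Q.head? = some u := by
    intro P' hP' hlen
    obtain ⟨S, hS, hc⟩ := lt_ncard_rotationEnds hexp hP'
      (by rintro rfl; simp at hlen; omega) fun Q hQ u hu z huz =>
        hext Q (hQ.spec hP').1 ((hQ.spec hP').2.1.length_eq.trans hlen) u hu z huz
    refine ⟨S, hc, fun u hu => ?_⟩
    obtain ⟨Q, hQ, hQu⟩ := hS u hu
    obtain ⟨h1, h2, h3⟩ := hQ.spec hP'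
    exact ⟨Q, h1, h2, h3, hQu⟩
  obtain ⟨S, hS, hSQ⟩ := hrot P hP rfl
  let U : Finset V := univ.filter (· ∉ P)
  by_cases hU : k < #U
  · -- Any pair of a rotation end and a vertex off the path is a booster.
    refine sq_le_two_mul_card hS (fun _ => U) (fun _ _ => hU) fun s hs w hw => hB _ (Or.inr ?_)
    obtain ⟨Q, hQ, hperm, -, hQs⟩ := hSQ s hs
    have hwQ : w ∉ Q := by
      rw [hperm.mem_iff]
      simpa [U] using hw
    refine ⟨w :: Q, (hQ.mono le_sup_left).cons hQs hwQ (Or.inr ?_), fun l hl => ?_⟩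
    · rw [fromEdgeSet_adj]
      refine ⟨Sym2.eq_swap, ?_⟩
      rintro rfl
      exact hwQ (List.mem_of_mem_head? hQs)
    · rw [List.length_cons, hperm.length_eq]
      exact Nat.lt_succ_of_le (hlong l hl)
  · -- Any pair of ends of a longest path is a booster.
    have hend : ∀ s ∈ S, ∃ T : Finset V, k + 1 ≤ #T ∧ ∀ t ∈ T, ∃ Q, IsPathList H Q ∧ Q.Perm P ∧
        Q.getLast? = some s ∧ Q.head? = some t := by
      intro s hs
      obtain ⟨Q, hQ, hperm, -, hQs⟩ := hSQ s hs
      obtain ⟨T, hT, hTQ⟩ := hrot Q.reverse hQ.reverse (by simp [hperm.length_eq])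
      refine ⟨T, hT, fun t ht => ?_⟩
      obtain ⟨Q', h1, h2, h3, h4⟩ := hTQ t ht
      exact ⟨Q', h1, h2.trans ((List.reverse_perm _).trans hperm), by simpa [hQs] using h3, h4⟩
    choose! T hT hTQ using hend
    refine sq_le_two_mul_card hS T hT fun s hs t ht => hB _ ?_
    obtain ⟨Q, hQ, hperm, hQs, hQt⟩ := hTQ s hs t ht
    have hst : s ≠ t := by
      rintro rfl
      -- A path whose ends coincide has one vertex, but the expansion provides an edge.
      obtain ⟨N, hN, hcard⟩ := hexp {s} (by simp) (by simpa using hk)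
      obtain ⟨w, hw⟩ : N.Nonempty := by rw [← card_pos]; omega
      obtain ⟨hws, v, hv, hvw⟩ := hN w hw
      obtain rfl : v = s := by simpa using hv
      have hwQ := hext Q hQ hperm.length_eq v hQt w hvw
      match Q, hQ, hQs, hQt, hwQ with
      | [], _, _, hQt, _ => simp at hQt
      | [a], _, _, hQt, hwQ => simp_all
      | a :: b :: Q, hQ, hQs, hQt, _ =>
        obtain rfl : a = v := by simpa using hQt
        rw [List.getLast?_cons_cons] at hQs
        exact (List.nodup_cons.1 hQ.2).1 (List.mem_of_mem_getLast? hQs)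
    have hadj : (H ⊔ fromEdgeSet {s(s, t)}).Adj s t := Or.inr (by simp [hst])
    have hQ' := hQ.mono (le_sup_left (b := fromEdgeSet {s(s, t)}))
    by_cases hU0 : U.Nonempty
    · right
      obtain ⟨N, hN, hcard⟩ := hexp U hU0 (by omega)
      obtain ⟨x, hx⟩ : N.Nonempty := by rw [← card_pos]; omega
      obtain ⟨hxU, w, hw, hwx⟩ := hN x hx
      obtain ⟨l', hl', hlt⟩ := hQ'.exists_longer hQt hQs hadj (x := x) (w := w)
        (by rw [hperm.mem_iff]; simpa [U] using hxU) (by rw [hperm.mem_iff]; simpa [U] using hw)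
        (Or.inl hwx)
      refine ⟨l', hl', fun l hl => ?_⟩
      have := hlong l hl
      have := hperm.length_eq
      omega
    · left
      refine hQ'.isHamiltonian (fun v => ?_) hQt hQs hadj hV
      rw [hperm.mem_iff]
      by_contra hv
      exact hU0 ⟨v, by simpa [U] using hv⟩

end Boosters

/-! ### Maker's strategy -/

section Game
variable {V : Type*} [DecidableEq V] {b : ℕ}

lemma fromEdgeSet_union_insert (E₀ E' : Finset (Sym2 V)) (e : Sym2 V) :
    fromEdgeSet (↑(E₀ ∪ insert e E') : Set (Sym2 V)) =
      fromEdgeSet ↑(E₀ ∪ E') ⊔ fromEdgeSet {e} := by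
  rw [← fromEdgeSet_union]
  congr 1
  ext x
  simp

/-- The number of members of `B` that contain `v`. -/
def incident (B : Finset (Sym2 V)) (v : V) : ℕ := #{e ∈ B | v ∈ e}

lemma incident_union_le (B S : Finset (Sym2 V)) (v : V) :
    incident (B ∪ S) v ≤ incident B v + incident S v := by
  unfold incident
  rw [filter_union]
  exact card_union_le _ _

lemma incident_le_card (S : Finset (Sym2 V)) (v : V) : incident S v ≤ #S := card_filter_le _ _

variable [Fintype V]

lemma makerWinsFrom_of_isHamiltonian {G H : SimpleGraph V} (hV : Fintype.card V ≠ 1)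
    {P : MBPlayer} {U M : Finset (Sym2 V)} (hH : H.IsHamiltonian) (hHM : H.edgeSet ⊆ M)
    (hMG : (M : Set (Sym2 V)) ⊆ G.edgeSet) :
    MakerWinsFrom b (hamiltonCycleEdgeSets G) P U M := by
  obtain ⟨a, p, hp⟩ := hH hV
  have hle : H ≤ G := edgeSet_subset_edgeSet.1 (hHM.trans hMG)
  refine .claimed P U M p.edges.toFinset
    ⟨a, p.map (.ofLE hle), hp.map Function.bijective_id, ?_⟩ fun e he => ?_
  · congr 1
    simp
  · exact hHM (p.edges_subset_edgeSet (List.mem_toFinset.1 he))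

/-- If every graph that consists of `E₀` and few edges of `R` has more boosters in `R` than edges
are ever claimed, then Maker, owning `E₀`, wins by claiming boosters. The sets `M` and `B` contain
the edges claimed by Maker and Breaker, and `E'` the boosters claimed so far. -/
lemma makerWinsFrom_of_boosters {G R : SimpleGraph V} (hV : Fintype.card V ≠ 1) (hRG : R ≤ G)
    {E₀ : Finset (Sym2 V)} {T : ℕ}
    (hboost : ∀ E' : Finset (Sym2 V), (E' : Set (Sym2 V)) ⊆ R.edgeSet → #E' ≤ Fintype.card V →
      ¬ (fromEdgeSet (↑(E₀ ∪ E') : Set (Sym2 V))).IsHamiltonian →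
      ∃ Y : Finset (Sym2 V), T < #Y ∧
        ∀ e ∈ Y, e ∈ R.edgeSet ∧ IsBooster (fromEdgeSet (↑(E₀ ∪ E') : Set (Sym2 V))) e)
    (E' : Finset (Sym2 V)) (l : List V) (U M B : Finset (Sym2 V))
    (hl : IsPathList (fromEdgeSet (↑(E₀ ∪ E') : Set (Sym2 V))) l) (hE'l : #E' ≤ l.length)
    (hE'M : E₀ ∪ E' ⊆ M) (hE'R : (E' : Set (Sym2 V)) ⊆ R.edgeSet)
    (hMG : (M : Set (Sym2 V)) ⊆ G.edgeSet) (hR : R.edgeSet ⊆ ↑(U ∪ M ∪ B))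
    (hcard : #M + #B + (b + 1) * (Fintype.card V - l.length) ≤ T) :
    MakerWinsFrom b (hamiltonCycleEdgeSets G) .maker U M := by
  induction hd : Fintype.card V - l.length using Nat.strong_induction_on
    generalizing E' l U M B with
  | _ d ih =>
  subst hd
  have hsub : ∀ {E M : Finset (Sym2 V)}, E ⊆ M →
      (fromEdgeSet (E : Set (Sym2 V))).edgeSet ⊆ M := by
    intro E M h
    rw [edgeSet_fromEdgeSet]
    exact Set.sdiff_subset.trans (by exact_mod_cast h)
  by_cases hH : (fromEdgeSet (↑(E₀ ∪ E') : Set (Sym2 V))).IsHamiltonian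
  · exact makerWinsFrom_of_isHamiltonian hV hH (hsub hE'M) hMG
  obtain ⟨Y, hY, hYe⟩ := hboost E' hE'R (hE'l.trans hl.length_le) hH
  obtain ⟨e, heY, heMB⟩ : ∃ e ∈ Y, e ∉ M ∪ B := by
    by_contra! hc
    have h1 := card_le_card (show Y ⊆ M ∪ B from hc)
    have h2 := card_union_le M B
    omega
  obtain ⟨heR, hebo⟩ := hYe e heY
  have heU : e ∈ U := by
    have := hR heR
    simp only [coe_union, Set.mem_union, mem_coe] at this
    simp only [mem_union] at heMB
    tauto
  have hMG' : (↑(insert e M) : Set (Sym2 V)) ⊆ G.edgeSet := by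
    rw [coe_insert]
    exact Set.insert_subset (edgeSet_subset_edgeSet.2 hRG heR) hMG
  have hE'M' : E₀ ∪ insert e E' ⊆ insert e M := by
    intro x hx
    have := @hE'M x
    simp only [mem_union, mem_insert] at hx this ⊢
    tauto
  refine .makerMove U M e heU ?_
  unfold IsBooster at hebo
  rw [← fromEdgeSet_union_insert] at hebo
  rcases hebo with hham | ⟨l', hl', hlt⟩
  · exact makerWinsFrom_of_isHamiltonian hV hham (hsub hE'M') hMG'
  refine .breakerMove _ _ fun S hSU hS => ?_
  have h1 := hlt l hl
  have h2 := hl'.length_le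
  refine ih (Fintype.card V - l'.length) (by omega) (insert e E') l' _ _ (B ∪ S) hl' ?_ hE'M' ?_
    hMG' ?_ ?_ rfl
  · have := card_insert_le e E'
    omega
  · rw [coe_insert]
    exact Set.insert_subset heR hE'R
  · intro x hx
    have := hR hx
    simp only [coe_union, Set.mem_union, mem_coe, mem_insert, mem_sdiff,
      mem_erase] at this ⊢
    tauto
  · have h3 := card_insert_le e M
    have h4 := card_union_le B S
    have h5 : #S ≤ b := by omega
    have h6 : Fintype.card V - l.length = (Fintype.card V - l'.length) + 1 +
      (l'.length - l.length - 1) := by omega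
    have h7 : (b + 1) * (Fintype.card V - l'.length) + (b + 1) ≤
        (b + 1) * (Fintype.card V - l.length) := by
      rw [h6]
      nlinarith
    omega

lemma sum_incident_le (S : Finset (Sym2 V)) : ∑ v, incident S v ≤ 2 * #S := by
  unfold incident
  simp_rw [card_filter]
  rw [sum_comm, mul_comm, ← smul_eq_mul]
  refine sum_le_card_nsmul _ _ _ fun e _ => ?_
  rw [← card_filter]
  induction e with | _ a b =>
  refine (card_le_card (t := {a, b}) fun x hx => ?_).trans card_le_two
  simpa using hx

/-- After the vertex `v` has lost `incident B v` edges, the remaining ones still lead to many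
vertices. -/
lemma le_card_filter_notMem (G : SimpleGraph V) [DecidableRel G.Adj] (B : Finset (Sym2 V)) (v : V)
    {d : ℕ} (hdeg : 2 * d ≤ G.degree v) (hB : incident B v ≤ d) :
    d ≤ #{w ∈ G.neighborFinset v | s(v, w) ∉ B} := by
  have h1 := card_filter_add_card_filter_not (s := G.neighborFinset v) (fun w => s(v, w) ∈ B)
  have h2 : #{w ∈ G.neighborFinset v | s(v, w) ∈ B} ≤ incident B v := by
    refine card_le_card_of_injOn (fun w => s(v, w)) (fun w hw => ?_) fun w _ w' _ h => ?_
    · simp_all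
    · exact Sym2.congr_right.1 h
  rw [card_neighborFinset_eq_degree] at h1
  omega

variable {D : ℕ}

/-- The conditional expectation of the number of bad events, when `f` is fixed outside `A` and
chosen at random on `A`. The event `e` occurs if `f x ∈ F e x` for all `x`, and `ω e x` bounds the
conditional probability of `f x ∈ F e x`. -/
noncomputable def eventWeight {ι : Type*} (𝓔 : Finset ι) (F : ι → V × Fin D → Finset V)
    (ω : ι → V × Fin D → ℝ) (A : Finset (V × Fin D)) (f : V × Fin D → V) : ℝ :=
  ∑ e ∈ 𝓔, ∏ x, if x ∈ A then ω e x else if f x ∈ F e x then 1 else 0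

/-- Method of conditional expectations: some value of `f x` in the sufficiently large set `W` does
not increase the expected number of bad events. -/
lemma exists_eventWeight_le {ι : Type*} {𝓔 : Finset ι} {F : ι → V × Fin D → Finset V}
    {ω : ι → V × Fin D → ℝ} (hω0 : ∀ e x, 0 ≤ ω e x) {W : Finset V} (hW : W.Nonempty)
    (hω : ∀ e ∈ 𝓔, ∀ x, (#(W ∩ F e x) : ℝ) ≤ ω e x * #W)
    (A : Finset (V × Fin D)) (f : V × Fin D → V) {x : V × Fin D} (hx : x ∈ A) :
    ∃ w ∈ W, eventWeight 𝓔 F ω (A.erase x) (Function.update f x w) ≤ eventWeight 𝓔 F ω A f := by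
  have hsum : ∑ w ∈ W, eventWeight 𝓔 F ω (A.erase x) (Function.update f x w) ≤
      ∑ w ∈ W, eventWeight 𝓔 F ω A f := by
    unfold eventWeight
    rw [sum_comm, sum_comm (s := W) (t := 𝓔)]
    refine sum_le_sum fun e he => ?_
    set r : ℝ := ∏ y ∈ univ.erase x,
      if y ∈ A then ω e y else if f y ∈ F e y then 1 else 0 with hr
    have hr0 : 0 ≤ r := by
      refine prod_nonneg fun y _ => ?_
      split_ifs
      exacts [hω0 e y, zero_le_one, le_rfl]
    have h1 : ∀ w, (∏ y, if y ∈ A.erase x then ω e y else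
        if Function.update f x w y ∈ F e y then 1 else 0) =
        (if w ∈ F e x then 1 else 0) * r := by
      intro w
      rw [← mul_prod_erase univ _ (mem_univ x)]
      congr 1
      · simp
      · refine prod_congr rfl fun y hy => ?_
        have hyx : y ≠ x := ne_of_mem_erase hy
        simp [hyx]
    have h2 : (∏ y, if y ∈ A then ω e y else if f y ∈ F e y then 1 else 0) = ω e x * r := by
      rw [← mul_prod_erase univ _ (mem_univ x), if_pos hx]
    simp_rw [h1, h2]
    rw [← sum_mul, sum_boole, filter_mem_eq_inter, sum_const, nsmul_eq_mul, ← mul_assoc]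
    refine mul_le_mul_of_nonneg_right ?_ hr0
    rw [mul_comm]
    exact hω e he x
  exact exists_le_of_sum_le hW hsum

/-- Maker can choose, for every `x = (v, i)`, an edge from `v` to a vertex `f x` such that no bad
event occurs. She always serves a vertex of maximal danger `β ^ incident B v`, which keeps the total
danger below `K` and so leaves at least `d` admissible choices for `f x`. The set `A` consists of
the `x` for which `f x` is still to be chosen. -/
lemma makerWinsFrom_of_eventWeight {G : SimpleGraph V} {𝓕 : Set (Finset (Sym2 V))}
    {G₁ : SimpleGraph V} [DecidableRel G₁.Adj] (hG₁ : G₁ ≤ G) {d : ℕ} (hd : 1 ≤ d)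
    (hdeg : ∀ v, 2 * d ≤ G₁.degree v) {β γ K : ℝ} (hβ1 : 1 ≤ β)
    (hβ : ∀ k ≤ b, β ^ k ≤ 1 + k * γ) (hγ0 : 0 ≤ γ) (hγ : D * (2 * b) * γ ≤ 1)
    (hK : K < β ^ (d + 1))
    {ι : Type*} {𝓔 : Finset ι} {F : ι → V × Fin D → Finset V} {ω : ι → V × Fin D → ℝ}
    (hω0 : ∀ e x, 0 ≤ ω e x)
    (hω : ∀ e ∈ 𝓔, ∀ x, ∀ W : Finset V, d ≤ #W → (#(W ∩ F e x) : ℝ) ≤ ω e x * #W) {T : ℕ}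
    (hend : ∀ (f : V × Fin D → V) (U M B : Finset (Sym2 V)), (∀ x, s(x.1, f x) ∈ M) →
      (∀ e ∈ 𝓔, ∃ x, f x ∉ F e x) → (M : Set (Sym2 V)) ⊆ G.edgeSet →
      G.edgeSet ⊆ ↑(U ∪ M ∪ B) → #M + #B ≤ T → MakerWinsFrom b 𝓕 .maker U M)
    (A : Finset (V × Fin D)) (f : V × Fin D → V) (U M B : Finset (Sym2 V))
    (hf : ∀ x, x ∉ A → s(x.1, f x) ∈ M)
    (hdanger : ∑ x ∈ A, β ^ incident B x.1 ≤ K) (hevent : eventWeight 𝓔 F ω A f < 1)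
    (hMG : (M : Set (Sym2 V)) ⊆ G.edgeSet) (hG : G.edgeSet ⊆ ↑(U ∪ M ∪ B))
    (hcard : #M + #B + (b + 1) * #A ≤ T) : MakerWinsFrom b 𝓕 .maker U M := by
  induction hn : #A generalizing A f U M B with
  | zero =>
    obtain rfl : A = ∅ := card_eq_zero.1 hn
    refine hend f U M B (fun x => hf x (notMem_empty _)) (fun e he => ?_) hMG hG
      (by simpa using hcard)
    by_contra! hc
    refine absurd hevent (not_lt.2 ?_)
    refine le_trans ?_ (single_le_sum (fun e _ => prod_nonneg fun x _ => ?_) he)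
    · simp [hc]
    · simp only [notMem_empty, if_false]
      split_ifs <;> norm_num
  | succ n ih =>
    have hβ0 : 0 < β := by linarith
    obtain ⟨x, hxA, hxmax⟩ := A.exists_max_image (fun x => β ^ incident B x.1)
      (card_pos.1 (by omega))
    have hcA : #(A.erase x) = n := by rw [card_erase_of_mem hxA]; omega
    have hBd : incident B x.1 ≤ d := by
      by_contra! hlt
      have h1 : β ^ (d + 1) ≤ β ^ incident B x.1 := pow_le_pow_right₀ hβ1 hlt
      have h2 : β ^ incident B x.1 ≤ ∑ x ∈ A, β ^ incident B x.1 :=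
        single_le_sum (f := fun x : V × Fin D => β ^ incident B x.1)
          (fun y _ => by positivity) hxA
      linarith
    set W : Finset V := {w ∈ G₁.neighborFinset x.1 | s(x.1, w) ∉ B} with hW
    have hWd : d ≤ #W := le_card_filter_notMem G₁ B x.1 (hdeg x.1) hBd
    obtain ⟨w, hw, hle⟩ := exists_eventWeight_le hω0 (card_pos.1 (by omega : 0 < #W))
      (fun e he x => hω e he x W hWd) A f hxA
    rw [hW, mem_filter, mem_neighborFinset] at hw
    have hwG : s(x.1, w) ∈ G.edgeSet := hG₁ hw.1
    have hf' : ∀ M', M ⊆ M' → s(x.1, w) ∈ M' →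
        ∀ y, y ∉ A.erase x → s(y.1, Function.update f x w y) ∈ M' := by
      intro M' hMM' hM' y hy
      by_cases hyx : y = x
      · subst hyx
        simpa using hM'
      · rw [Function.update_of_ne hyx]
        exact hMM' (hf y fun h => hy (mem_erase.2 ⟨hyx, h⟩))
    have hsplit := add_sum_erase A (fun x => β ^ incident B x.1) hxA
    have hpow : (b + 1) * #A = (b + 1) * #(A.erase x) + (b + 1) := by rw [hn, hcA]; ring
    -- An edge that Maker owns already, chosen from its other end, costs no move.
    by_cases hM : s(x.1, w) ∈ M
    · refine ih (A.erase x) _ U M B (hf' M subset_rfl hM) ?_ (hle.trans_lt hevent) hMG hG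
        (by omega) hcA
      have : 0 < β ^ incident B x.1 := by positivity
      linarith
    · have hU : s(x.1, w) ∈ U := by
        have := hG hwG
        simp only [coe_union, Set.mem_union, mem_coe] at this
        tauto
      refine .makerMove U M _ hU (.breakerMove _ _ fun S hSU hS => ?_)
      have hSb : #S ≤ b := by omega
      refine ih (A.erase x) _ _ _ (B ∪ S) (hf' _ (subset_insert _ _) (mem_insert_self _ _)) ?_
        (hle.trans_lt hevent) ?_ ?_ ?_ hcA
      · -- Breaker's `b` edges raise the total danger by at most the danger of the served vertex.
        have h1 : ∀ y ∈ A.erase x, β ^ incident (B ∪ S) y.1 ≤ β ^ incident B y.1 +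
            β ^ incident B x.1 * γ * incident S y.1 := by
          intro y hy
          calc β ^ incident (B ∪ S) y.1 ≤ β ^ (incident B y.1 + incident S y.1) :=
                pow_le_pow_right₀ hβ1 (incident_union_le _ _ _)
            _ = β ^ incident B y.1 * β ^ incident S y.1 := pow_add _ _ _
            _ ≤ β ^ incident B y.1 * (1 + incident S y.1 * γ) := by
                gcongr
                exact hβ _ ((incident_le_card _ _).trans hSb)
            _ = β ^ incident B y.1 + β ^ incident B y.1 * γ * incident S y.1 := by ring
            _ ≤ _ := by
                gcongr β ^ incident B y.1 + ?_ * γ * _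
                exact hxmax y (mem_of_mem_erase hy)
        have h2 : (∑ y ∈ A.erase x, (incident S y.1 : ℝ)) ≤ D * (2 * b) := by
          calc (∑ y ∈ A.erase x, (incident S y.1 : ℝ)) ≤ ∑ y : V × Fin D, (incident S y.1 : ℝ) :=
                sum_le_sum_of_subset_of_nonneg (subset_univ _) fun _ _ _ => by positivity
            _ = D * ∑ v, (incident S v : ℝ) := by
                rw [Fintype.sum_prod_type]
                simp [mul_sum]
            _ ≤ D * (2 * b) := by
                gcongr
                exact_mod_cast (sum_incident_le S).trans (by omega)
        have h3 : β ^ incident B x.1 * γ * ∑ y ∈ A.erase x, (incident S y.1 : ℝ) ≤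
            β ^ incident B x.1 := by
          calc β ^ incident B x.1 * γ * ∑ y ∈ A.erase x, (incident S y.1 : ℝ)
              ≤ β ^ incident B x.1 * γ * (D * (2 * b)) := by gcongr
            _ = β ^ incident B x.1 * (D * (2 * b) * γ) := by ring
            _ ≤ β ^ incident B x.1 * 1 := by gcongr
            _ = _ := mul_one _
        have h4 := sum_le_sum h1
        rw [sum_add_distrib, ← mul_sum] at h4
        linarith
      · rw [coe_insert]
        exact Set.insert_subset hwG hMG
      · intro y hy
        have := hG hy
        simp only [coe_union, Set.mem_union, mem_coe, mem_insert, mem_sdiff,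
          mem_erase] at this ⊢
        tauto
      · have h3 := card_insert_le s(x.1, w) M
        have h4 := card_union_le B S
        omega

end Game

/-! ### A deterministic criterion -/

section Deterministic
variable {V : Type*} [Fintype V] [DecidableEq V] {b D : ℕ}

/-- The edges from the vertices `v` to the vertices `f (v, i)` chosen for them. -/
def outEdges (f : V × Fin D → V) : Finset (Sym2 V) := univ.image fun x => s(x.1, f x)

/-- If `f` maps no set of few columns `A × Fin D` into a set of size `4 * #A`, then its edges form
an expander. -/
lemma expands_outEdges {f : V × Fin D → V} {k : ℕ} (hk : 4 * k ≤ Fintype.card V)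
    (hf : ∀ A B : Finset V, A.Nonempty → #A ≤ k → #B = 4 * #A → ∃ x, x.1 ∈ A ∧ f x ∉ B)
    (E' : Finset (Sym2 V)) :
    Expands (fromEdgeSet (↑(outEdges f ∪ E') : Set (Sym2 V))) k := by
  intro A hA hAk
  set N : Finset V := (A ×ˢ univ).image f with hN
  have h1 : 4 * #A < #N := by
    by_contra! hc
    obtain ⟨B, hNB, -, hB⟩ := exists_subsuperset_card_eq (subset_univ N) hc
      (by rw [card_univ]; omega)
    obtain ⟨x, hxA, hxB⟩ := hf A B hA hAk hB
    exact hxB (hNB (mem_image_of_mem f (by simp [hxA])))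
  refine ⟨N \ A, fun w hw => ?_, ?_⟩
  · rw [mem_sdiff, hN, mem_image] at hw
    obtain ⟨⟨x, hx, rfl⟩, hwA⟩ := hw
    have hxA : x.1 ∈ A := by simpa using hx
    refine ⟨hwA, x.1, hxA, ?_⟩
    rw [fromEdgeSet_adj]
    refine ⟨?_, fun h => hwA (h ▸ hxA)⟩
    simp only [outEdges, coe_union, coe_image, coe_univ, Set.image_univ]
    exact Or.inl ⟨x, rfl⟩
  · have := le_card_sdiff A N
    omega

/-- The choices `f` of edges are bad for `R` if they can be completed to a non-Hamiltonian expander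
by few edges of `R` such that at most `T` boosters lie in `R`. -/
def IsBad (k T : ℕ) (R : SimpleGraph V) (f : V × Fin D → V) : Prop :=
  ∃ E' : Finset (Sym2 V), (E' : Set (Sym2 V)) ⊆ R.edgeSet ∧ #E' ≤ Fintype.card V ∧
    Expands (fromEdgeSet (↑(outEdges f ∪ E') : Set (Sym2 V))) k ∧
    ¬ (fromEdgeSet (↑(outEdges f ∪ E') : Set (Sym2 V))).IsHamiltonian ∧
    ∀ Y : Finset (Sym2 V), (∀ e ∈ Y, e ∈ R.edgeSet ∧
      IsBooster (fromEdgeSet (↑(outEdges f ∪ E') : Set (Sym2 V))) e) → #Y ≤ T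

/-- The pairs `(A, B)` for which a choice of edges is bad if it leads from `A` into `B` only. -/
def narrowPairs (V : Type*) [Fintype V] [DecidableEq V] (k : ℕ) : Finset (Finset V × Finset V) :=
  {P | P.1.Nonempty ∧ #P.1 ≤ k ∧ #P.2 = 4 * #P.1}

open Classical in
/-- Maker wins if bad choices of edges are rare, both those that do not expand and those that are
bad for `R`. -/
theorem makerWinsHamiltonicity_of_sum_lt {G₁ R : SimpleGraph V} {d k : ℕ}
    (hV : 3 ≤ Fintype.card V) (hb : 1 ≤ b) (hD : 1 ≤ D) (hd : 1 ≤ d)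
    (hdeg : ∀ v, 2 * d ≤ G₁.degree v) (hk : 4 * k ≤ Fintype.card V)
    (hlog : 4 * b * D * Real.log (2 * Fintype.card V * D) < d + 1)
    (hnarrow : ∑ P ∈ narrowPairs V k, ((#P.2 : ℝ) / d) ^ (D * #P.1) ≤ 1 / 2)
    (hbad : (#{f : V × Fin D → V |
        IsBad k (b + (b + 1) * (Fintype.card V * D) + (b + 1) * Fintype.card V) R f} : ℝ) *
      (1 / d) ^ (Fintype.card V * D) < 1 / 2) :
    MakerWinsHamiltonicity b (G₁ ⊔ R) := by
  set T₁ : ℕ := b + (b + 1) * (Fintype.card V * D) with hT₁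
  set T : ℕ := T₁ + (b + 1) * Fintype.card V with hT
  have hd0 : (0 : ℝ) < d := by exact_mod_cast hd
  have hb0 : (0 : ℝ) < b := by exact_mod_cast hb
  have hD1 : (1 : ℝ) ≤ D := by exact_mod_cast hD
  have hV0 : (0 : ℝ) < Fintype.card V := by exact_mod_cast (by omega : 0 < Fintype.card V)
  set G : SimpleGraph V := G₁ ⊔ R
  -- One move of Breaker multiplies a danger by at most `β ^ b = exp (1 / (4 * D))`, and `γ` is
  -- chosen such that `β ^ k ≤ 1 + k * γ` up to `k = b`.
  set β : ℝ := Real.exp (1 / (4 * b * D)) with hβdef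
  set γ : ℝ := 1 / (2 * b * D) with hγdef
  set K : ℝ := 2 * Fintype.card V * D with hKdef
  have hβ1 : 1 ≤ β := Real.one_le_exp (by positivity)
  have hβ : ∀ k ≤ b, β ^ k ≤ 1 + k * γ := by
    intro k hk
    have hk' : (k : ℝ) ≤ b := by exact_mod_cast hk
    rw [hβdef, ← Real.exp_nat_mul]
    have hx0 : 0 ≤ (k : ℝ) * (1 / (4 * b * D)) := by positivity
    have hx1 : (k : ℝ) * (1 / (4 * b * D)) ≤ 1 := by
      rw [mul_one_div, div_le_one (by positivity)]
      nlinarith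
    have h1 := Real.abs_exp_sub_one_le (x := (k : ℝ) * (1 / (4 * b * D)))
      (by rwa [abs_of_nonneg hx0])
    rw [abs_of_nonneg hx0] at h1
    have h2 := (abs_le.1 h1).2
    have h3 : (k : ℝ) * γ = 2 * (k * (1 / (4 * b * D))) := by
      rw [hγdef]; field_simp; norm_num
    linarith
  have hγ0 : 0 ≤ γ := by positivity
  have hγ : D * (2 * b) * γ ≤ 1 := by
    rw [hγdef]
    apply le_of_eq
    field_simp
  have hK : K < β ^ (d + 1) := by
    rw [hβdef, ← Real.exp_nat_mul, ← Real.log_lt_iff_lt_exp (by positivity), mul_one_div,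
      lt_div_iff₀ (by positivity)]
    push_cast
    linarith
  -- The bad events: `f` leads from `P.1` into `P.2` only, or `f` is a function bad for `R`.
  let 𝓔 : Finset ((Finset V × Finset V) ⊕ (V × Fin D → V)) :=
    (narrowPairs V k).disjSum {f | IsBad k T R f}
  let F : (Finset V × Finset V) ⊕ (V × Fin D → V) → V × Fin D → Finset V :=
    Sum.elim (fun P x => if x.1 ∈ P.1 then P.2 else univ) fun f x => {f x}
  let ω : (Finset V × Finset V) ⊕ (V × Fin D → V) → V × Fin D → ℝ :=
    Sum.elim (fun P x => if x.1 ∈ P.1 then (#P.2 : ℝ) / d else 1) fun f x => 1 / d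
  have hω0 : ∀ e x, 0 ≤ ω e x := by
    rintro (P | f) x
    · simp only [ω, Sum.elim_inl]
      split_ifs <;> positivity
    · simp only [ω, Sum.elim_inr]
      positivity
  have hωs : ∀ (W S : Finset V), d ≤ #W → (#(W ∩ S) : ℝ) ≤ (#S : ℝ) / d * #W := by
    intro W S hW
    have h1 : (#(W ∩ S) : ℝ) ≤ #S := by exact_mod_cast card_le_card inter_subset_right
    have h2 : (d : ℝ) ≤ #W := by exact_mod_cast hW
    calc (#(W ∩ S) : ℝ) ≤ #S := h1
      _ = #S / d * d := by field_simp
      _ ≤ _ := by gcongr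
  have hω : ∀ e ∈ 𝓔, ∀ x, ∀ W : Finset V, d ≤ #W → (#(W ∩ F e x) : ℝ) ≤ ω e x * #W := by
    rintro (P | f) - x W hW
    · simp only [F, ω, Sum.elim_inl]
      split_ifs
      · exact hωs W P.2 hW
      · simp
    · simp only [F, ω, Sum.elim_inr]
      simpa using hωs W {f x} hW
  have hweight : ∀ f, eventWeight 𝓔 F ω univ f < 1 := by
    intro f
    unfold eventWeight
    rw [sum_disjSum]
    simp only [mem_univ, if_true, ω, Sum.elim_inl, Sum.elim_inr, prod_const, sum_const,
      nsmul_eq_mul]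
    have h1 : ∀ P : Finset V × Finset V, ∏ x : V × Fin D,
        (if x.1 ∈ P.1 then (#P.2 : ℝ) / d else 1) = ((#P.2 : ℝ) / d) ^ (D * #P.1) := by
      intro P
      refine (Fintype.prod_prod_type' fun v (_ : Fin D) =>
        if v ∈ P.1 then (#P.2 : ℝ) / d else 1).trans ?_
      simp only [prod_const, card_univ, Fintype.card_fin, ite_pow, one_pow]
      rw [prod_ite_mem, univ_inter, prod_const, ← pow_mul]
    simp_rw [h1]
    rw [card_univ, Fintype.card_prod, Fintype.card_fin]
    linarith
  have hend : ∀ (f : V × Fin D → V) (U M B : Finset (Sym2 V)), (∀ x, s(x.1, f x) ∈ M) →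
      (∀ e ∈ 𝓔, ∃ x, f x ∉ F e x) → (M : Set (Sym2 V)) ⊆ G.edgeSet →
      G.edgeSet ⊆ ↑(U ∪ M ∪ B) → #M + #B ≤ T₁ →
      MakerWinsFrom b (hamiltonCycleEdgeSets G) .maker U M := by
    intro f U M B hfM hf hMG hG hcard
    have hexp := fun E' => expands_outEdges (f := f) (E' := E') hk fun A B hA hAk hB => by
      obtain ⟨x, hx⟩ := hf (.inl (A, B)) (by simp [𝓔, narrowPairs, hAk, hB, hA])
      simp only [F, Sum.elim_inl] at hx
      by_cases hxA : x.1 ∈ A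
      · exact ⟨x, hxA, by simpa [hxA] using hx⟩
      · simp [hxA] at hx
    have hnb : ¬ IsBad k T R f := by
      intro hb
      obtain ⟨x, hx⟩ := hf (.inr f) (by simp [𝓔, hb])
      simp [F] at hx
    refine makerWinsFrom_of_boosters (T := T) (R := R) (E₀ := outEdges f) (B := B) (by omega)
      le_sup_right (fun E' hE' hE'c hham => ?_) ∅ [] U M ⟨by simp, by simp⟩ (by simp) ?_ (by simp)
      hMG ?_ (by simp; omega)
    · by_contra! hc
      exact hnb ⟨E', hE', hE'c, hexp E', hham, fun Y hY => by
        by_contra! hlt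
        obtain ⟨e, he, he'⟩ := hc Y hlt
        exact he' (hY e he).1 (hY e he).2⟩
    · intro e he
      simp only [outEdges, union_empty, mem_image, mem_univ, true_and] at he
      obtain ⟨x, rfl⟩ := he
      exact hfM x
    · exact (edgeSet_subset_edgeSet.2 le_sup_right).trans hG
  have hmain : ∀ U B : Finset (Sym2 V), #B ≤ b → G.edgeSet ⊆ ↑(U ∪ B) →
      MakerWinsFrom b (hamiltonCycleEdgeSets G) .maker U ∅ := by
    intro U B hB hG
    obtain ⟨v⟩ : Nonempty V := Fintype.card_pos_iff.1 (by omega)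
    refine makerWinsFrom_of_eventWeight (G := G) (G₁ := G₁) (D := D) le_sup_left hd hdeg hβ1 hβ hγ0
      hγ hK hω0 hω hend univ (fun _ => v) U ∅ B (by simp) ?_ (hweight _) (by simp)
      (by simpa using hG) ?_
    · calc ∑ x : V × Fin D, β ^ incident B x.1 ≤ ∑ x : V × Fin D, 2 := by
            refine sum_le_sum fun x _ => ?_
            have h1 := hβ _ ((incident_le_card B x.1).trans hB)
            have h2 : (incident B x.1 : ℝ) ≤ b := by
              exact_mod_cast (incident_le_card B x.1).trans hB
            have h3 : (incident B x.1 : ℝ) * γ ≤ b * γ := by gcongr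
            have h4 : b * γ ≤ D * (2 * b) * γ := by
              gcongr
              nlinarith
            linarith
        _ = K := by
            simp [hKdef, Fintype.card_prod]
            ring
    · simp [Fintype.card_prod, hT₁]
      omega
  intro first
  unfold MakerWinsGame
  have hboard : G.edgeSet ⊆ ((Set.toFinite G.edgeSet).toFinset : Set (Sym2 V)) := by simp
  cases first with
  | maker => exact hmain _ ∅ (by simp) (by simp)
  | breaker =>
    refine .breakerMove _ _ fun S hS hSc => hmain _ S (by omega) ?_
    intro e he
    have := hboard he
    simp only [mem_coe, coe_union, Set.mem_union, mem_sdiff] at this ⊢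
    tauto

end Deterministic

/-! ### The random graph -/

section Random

lemma measurableSet_graph {V : Type*} [Finite V] (S : Set (SimpleGraph V)) : MeasurableSet S := by
  have : MeasurableSingletonClass (SimpleGraph V) := ⟨fun G => by
    have : ({G} : Set (SimpleGraph V)) = edgeSet ⁻¹' {G.edgeSet} := by
      ext H
      simp
    rw [this]
    exact measurable_edgeSet (MeasurableSet.singleton _)⟩
  exact S.toFinite.measurableSet

variable {V : Type*} [Fintype V] [DecidableEq V]

lemma real_eq_sum_singleton (μ : MeasureTheory.Measure (SimpleGraph V))
    [MeasureTheory.IsFiniteMeasure μ] (S : Set (SimpleGraph V)) [DecidablePred (· ∈ S)] :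
    μ.real S = ∑ G, if G ∈ S then μ.real {G} else 0 := by
  have : MeasurableSingletonClass (SimpleGraph V) := ⟨fun _ => measurableSet_graph _⟩
  rw [← sum_filter, MeasureTheory.sum_measureReal_singleton]
  simp

variable (V) in
/-- The potential edges on the vertex set `V`. -/
def nonDiag : Finset (Sym2 V) := {e | ¬ e.IsDiag}

lemma real_singleton_fromEdgeSet (p : unitInterval) {t : Finset (Sym2 V)} (ht : t ⊆ nonDiag V) :
    (binomialRandom V p).real {fromEdgeSet (t : Set (Sym2 V))} =
      (p : ℝ) ^ #t * (1 - p : ℝ) ^ #(nonDiag V \ t) := by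
  have h1 : (fromEdgeSet (t : Set (Sym2 V))).edgeSet = t := by
    rw [edgeSet_fromEdgeSet, sdiff_eq_left, Set.disjoint_left]
    intro e he hd
    have := ht he
    simp only [nonDiag, mem_filter, mem_univ, true_and] at this
    exact this hd
  have h2 : #(nonDiag V) = (Nat.card V).choose 2 := by
    rw [Nat.card_eq_fintype_card, ← Sym2.card_subtype_not_diag, Fintype.card_subtype, nonDiag]
  rw [MeasureTheory.measureReal_def, binomialRandom_singleton, h1, Set.ncard_coe_finset,
    card_sdiff_of_subset ht, h2]
  simp

/-- The expectation of a function of the binomial random graph. -/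
lemma sum_real_singleton_mul (p : unitInterval) (g : SimpleGraph V → ℝ) :
    ∑ G, (binomialRandom V p).real {G} * g G =
      ∑ t ∈ (nonDiag V).powerset,
        (p : ℝ) ^ #t * (1 - p : ℝ) ^ #(nonDiag V \ t) * g (fromEdgeSet (t : Set (Sym2 V))) := by
  classical
  symm
  refine sum_nbij' (fun t => fromEdgeSet (t : Set (Sym2 V))) (fun G => G.edgeFinset) (by simp)
    ?_ ?_ (by simp) ?_
  · intro G _
    rw [mem_powerset]
    intro e he
    simp only [nonDiag, mem_filter, mem_univ, true_and]
    exact G.not_isDiag_of_mem_edgeSet (mem_edgeFinset.1 he)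
  · intro t ht
    ext e
    rw [mem_powerset] at ht
    simp only [mem_edgeFinset, edgeSet_fromEdgeSet, Set.mem_sdiff, mem_coe]
    refine ⟨fun h => h.1, fun h => ⟨h, ?_⟩⟩
    simpa [nonDiag] using ht h
  · intro t ht
    rw [real_singleton_fromEdgeSet p (mem_powerset.1 ht)]

/-- The probability that the random graph contains `E'`, but at most `T` members of the disjoint set
`Y`. -/
lemma real_subset_and_few_le (p : unitInterval) {E' Y : Finset (Sym2 V)} (hE' : E' ⊆ nonDiag V)
    (hY : Y ⊆ nonDiag V) (hdisj : Disjoint E' Y) (T : ℕ) :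
    (binomialRandom V p).real {R | (E' : Set (Sym2 V)) ⊆ R.edgeSet ∧
        ∀ Y' ⊆ Y, (Y' : Set (Sym2 V)) ⊆ R.edgeSet → #Y' ≤ T} ≤
      2 ^ T * (p : ℝ) ^ #E' * (1 - p / 2 : ℝ) ^ #Y := by
  classical
  have hp0 : (0 : ℝ) ≤ p := p.2.1
  have hp1 : (p : ℝ) ≤ 1 := p.2.2
  -- The indicator function of the event is bounded by a product over the potential edges.
  let E : SimpleGraph V → Finset (Sym2 V) := fun R => {e | e ∈ R.edgeSet}
  have hE : ∀ R e, e ∈ E R ↔ e ∈ R.edgeSet := by simp [E]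
  let g : SimpleGraph V → ℝ := fun R =>
    2 ^ T * ((∏ e ∈ E R, if e ∈ Y then 1 / 2 else 1) *
      ∏ e ∈ nonDiag V \ E R, if e ∈ E' then 0 else 1)
  have hg0 : ∀ R, 0 ≤ g R := by
    intro R
    refine mul_nonneg (by positivity) (mul_nonneg ?_ ?_) <;>
    · refine prod_nonneg fun e _ => ?_
      split_ifs <;> norm_num
  have hprod : ∀ (s t : Finset (Sym2 V)) (a : ℝ), (∏ e ∈ s, if e ∈ t then a else 1) =
      a ^ #(s ∩ t) := by
    intro s t a
    rw [prod_ite_mem, prod_const]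
  have hg1 : ∀ R : SimpleGraph V, (E' : Set (Sym2 V)) ⊆ R.edgeSet →
      (∀ Y' ⊆ Y, (Y' : Set (Sym2 V)) ⊆ R.edgeSet → #Y' ≤ T) → 1 ≤ g R := by
    intro R h1 h2
    have h3 := h2 (E R ∩ Y) inter_subset_right
      fun e he => (hE R e).1 (mem_inter.1 he).1
    have h4 : (nonDiag V \ E R) ∩ E' = ∅ := by
      ext e
      simp only [mem_inter, mem_sdiff, hE, notMem_empty, iff_false]
      rintro ⟨h5, h6⟩
      exact h5.2 (h1 h6)
    simp only [g]
    rw [hprod, hprod, h4, card_empty, pow_zero, mul_one, one_div, inv_pow, ← div_eq_mul_inv,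
      one_le_div (by positivity)]
    exact pow_le_pow_right₀ (by norm_num) h3
  rw [real_eq_sum_singleton]
  calc _ ≤ ∑ G, (binomialRandom V p).real {G} * g G := by
        refine sum_le_sum fun G _ => ?_
        split_ifs with h
        · exact le_mul_of_one_le_right MeasureTheory.measureReal_nonneg (hg1 G h.1 h.2)
        · exact mul_nonneg MeasureTheory.measureReal_nonneg (hg0 G)
    _ = 2 ^ T * ∏ e ∈ nonDiag V,
        ((p : ℝ) * (if e ∈ Y then 1 / 2 else 1) + (1 - p) * if e ∈ E' then 0 else 1) := by
        rw [sum_real_singleton_mul, prod_add, mul_sum]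
        refine sum_congr rfl fun t ht => ?_
        rw [mem_powerset] at ht
        have ht' : E (fromEdgeSet (t : Set (Sym2 V))) = t := by
          ext e
          simp only [hE, edgeSet_fromEdgeSet, Set.mem_sdiff, mem_coe]
          refine ⟨fun h => h.1, fun h => ⟨h, ?_⟩⟩
          simpa [nonDiag] using ht h
        simp only [g]
        rw [ht', prod_mul_distrib, prod_mul_distrib, prod_const, prod_const]
        ring
    _ = 2 ^ T * ∏ e ∈ nonDiag V,
        ((if e ∈ E' then (p : ℝ) else 1) * if e ∈ Y then (1 - p / 2 : ℝ) else 1) := by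
        congr 1
        refine prod_congr rfl fun e _ => ?_
        have : e ∈ E' → e ∉ Y := fun h => Finset.disjoint_left.1 hdisj h
        split_ifs <;> first | tauto | ring
    _ = _ := by
        rw [prod_mul_distrib, hprod, hprod, inter_eq_right.2 hE', inter_eq_right.2 hY, mul_assoc]

lemma card_nonDiag_le : #(nonDiag V) ≤ Fintype.card V ^ 2 := by
  have h : #(nonDiag V) = (Fintype.card V).choose 2 := by
    rw [← Sym2.card_subtype_not_diag, Fintype.card_subtype, nonDiag]
  rw [h]
  exact Nat.choose_le_pow _ _

/-- A fixed choice of edges is bad with exponentially small probability: each of its completions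
has quadratically many boosters, and the number of completions is compensated by the factor
`p ^ #E'` for their presence in the random graph. -/
lemma real_isBad_le {D : ℕ} (p : unitInterval) {k T : ℕ} (hk : 1 ≤ k) (hV : 3 ≤ Fintype.card V)
    (f : V × Fin D → V) {ρ : ℝ} (hρ0 : 0 < ρ) (hρ1 : ρ ≤ 1) :
    (binomialRandom V p).real {R | IsBad k T R f} ≤
      2 ^ T * (1 / ρ) ^ Fintype.card V *
        Real.exp (ρ * p * Fintype.card V ^ 2 - p * (k + 1) ^ 2 / 4) := by
  classical
  have hp0 : (0 : ℝ) ≤ p := p.2.1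
  have hp1 : (p : ℝ) ≤ 1 := p.2.2
  set n := Fintype.card V
  let H : Finset (Sym2 V) → SimpleGraph V :=
    fun E' => fromEdgeSet (↑(outEdges f ∪ E') : Set (Sym2 V))
  let Y : Finset (Sym2 V) → Finset (Sym2 V) := fun E' => {e | IsBooster (H E') e}
  -- `𝓔` holds the completions that leave a non-Hamiltonian expander, `Y` their boosters.
  let 𝓔 : Finset (Finset (Sym2 V)) := {E' ∈ (nonDiag V).powerset | #E' ≤ n ∧
    Expands (H E') k ∧ ¬ (H E').IsHamiltonian}
  let S : Finset (Sym2 V) → Set (SimpleGraph V) := fun E' => {R | (E' : Set (Sym2 V)) ⊆ R.edgeSet ∧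
    ∀ Y' ⊆ Y E', (Y' : Set (Sym2 V)) ⊆ R.edgeSet → #Y' ≤ T}
  have hsub : {R | IsBad k T R f} ⊆ ⋃ E' ∈ 𝓔, S E' := by
    rintro R ⟨E', h1, h2, h3, h4, h5⟩
    refine Set.mem_biUnion (x := E') ?_ ⟨h1, fun Y' hY' hY'R => h5 Y' fun e he => ⟨hY'R he, ?_⟩⟩
    · simp only [𝓔, coe_filter, mem_powerset, Set.mem_ofPred_eq]
      refine ⟨fun e he => ?_, h2, h3, h4⟩
      simp only [nonDiag, mem_filter, mem_univ, true_and]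
      exact R.not_isDiag_of_mem_edgeSet (h1 he)
    · exact (mem_filter.1 (hY' he)).2
  have hterm : ∀ E' ∈ 𝓔, (binomialRandom V p).real (S E') ≤
      2 ^ T * Real.exp (-(p * (k + 1) ^ 2 / 4)) * (1 / ρ) ^ n * (ρ * p) ^ #E' := by
    intro E' hE'
    simp only [𝓔, mem_filter, mem_powerset] at hE'
    obtain ⟨h1, h2, h3, h4⟩ := hE'
    have hYm : ∀ e ∈ Y E', e ∉ (H E').edgeSet ∧ ¬ e.IsDiag := by
      intro e he
      exact IsBooster.notMem (mem_filter.1 he).2 h4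
    have hYn : Y E' ⊆ nonDiag V := fun e he => by
      simpa [nonDiag] using (hYm e he).2
    have hdisj : Disjoint E' (Y E') := by
      rw [Finset.disjoint_left]
      intro e he heY
      apply (hYm e heY).1
      simp only [H, edgeSet_fromEdgeSet, coe_union]
      exact ⟨Or.inr he, by simpa using (hYm e heY).2⟩
    have hcard : ((k : ℝ) + 1) ^ 2 ≤ 2 * #(Y E') := by
      exact_mod_cast sq_le_two_mul_card_boosters hk hV h3 (B := Y E')
        (fun e he => mem_filter.2 ⟨mem_univ _, he⟩)
    calc (binomialRandom V p).real (S E') ≤ 2 ^ T * (p : ℝ) ^ #E' * (1 - p / 2 : ℝ) ^ #(Y E') :=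
          real_subset_and_few_le p h1 hYn hdisj T
      _ ≤ 2 ^ T * (p : ℝ) ^ #E' * Real.exp (-(p * (k + 1) ^ 2 / 4)) := by
          gcongr
          calc (1 - p / 2 : ℝ) ^ #(Y E') ≤ Real.exp (-(p / 2)) ^ #(Y E') := by
                gcongr
                · linarith
                · exact Real.one_sub_le_exp_neg _
            _ = Real.exp (-(p * (2 * #(Y E')) / 4)) := by
                rw [← Real.exp_nat_mul]
                ring_nf
            _ ≤ _ := by gcongr
      _ ≤ 2 ^ T * ((1 / ρ) ^ n * (ρ * p) ^ #E') * Real.exp (-(p * (k + 1) ^ 2 / 4)) := by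
          gcongr
          calc (p : ℝ) ^ #E' = (1 / ρ) ^ #E' * (ρ * p) ^ #E' := by
                rw [← mul_pow]
                congr 1
                field_simp
            _ ≤ (1 / ρ) ^ n * (ρ * p) ^ #E' := by
                gcongr
                rwa [le_div_iff₀ hρ0, one_mul]
      _ = _ := by ring
  calc (binomialRandom V p).real {R | IsBad k T R f}
      ≤ (binomialRandom V p).real (⋃ E' ∈ 𝓔, S E') :=
        MeasureTheory.measureReal_mono hsub (MeasureTheory.measure_ne_top _ _)
    _ ≤ ∑ E' ∈ 𝓔, (binomialRandom V p).real (S E') :=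
        MeasureTheory.measureReal_biUnion_finset_le _ _
    _ ≤ ∑ E' ∈ 𝓔, 2 ^ T * Real.exp (-(p * (k + 1) ^ 2 / 4)) * (1 / ρ) ^ n * (ρ * p) ^ #E' :=
        sum_le_sum hterm
    _ ≤ ∑ E' ∈ (nonDiag V).powerset,
          2 ^ T * Real.exp (-(p * (k + 1) ^ 2 / 4)) * (1 / ρ) ^ n * (ρ * p) ^ #E' :=
        sum_le_sum_of_subset_of_nonneg (filter_subset _ _) fun _ _ _ => by positivity
    _ = 2 ^ T * Real.exp (-(p * (k + 1) ^ 2 / 4)) * (1 / ρ) ^ n * (1 + ρ * p) ^ #(nonDiag V) := by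
        rw [← mul_sum]
        congr 1
        have := sum_pow_mul_eq_add_pow (ρ * p : ℝ) 1 (nonDiag V)
        simp only [one_pow, mul_one] at this
        rw [this, add_comm]
    _ ≤ 2 ^ T * Real.exp (-(p * (k + 1) ^ 2 / 4)) * (1 / ρ) ^ n *
          Real.exp (ρ * p * n ^ 2) := by
        gcongr
        calc (1 + ρ * p : ℝ) ^ #(nonDiag V) ≤ (1 + ρ * p) ^ (n ^ 2) :=
              pow_le_pow_right₀ (by nlinarith) card_nonDiag_le
          _ ≤ Real.exp (ρ * p) ^ (n ^ 2) := by
              gcongr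
              rw [add_comm]
              exact Real.add_one_le_exp _
          _ = Real.exp (ρ * p * n ^ 2) := by
              rw [← Real.exp_nat_mul]
              push_cast
              ring_nf
    _ = _ := by
        rw [sub_eq_add_neg, Real.exp_add]
        ring

open Classical in
/-- Markov's inequality for the number of members of a finite family of events that occur. -/
lemma real_le_card_le {ι : Type*} [Fintype ι] (μ : MeasureTheory.Measure (SimpleGraph V))
    [MeasureTheory.IsFiniteMeasure μ] (P : SimpleGraph V → ι → Prop) {c q : ℝ} (hc : 0 ≤ c)
    (hq : ∀ i, μ.real {R | P R i} ≤ q) :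
    μ.real {R | 1 / 2 ≤ (#{i | P R i} : ℝ) * c} ≤ 2 * c * (Fintype.card ι * q) := by
  calc μ.real {R | 1 / 2 ≤ (#{i | P R i} : ℝ) * c}
      ≤ ∑ R, 2 * c * (∑ i, if P R i then μ.real {R} else 0) := by
        rw [real_eq_sum_singleton]
        refine sum_le_sum fun R _ => ?_
        rw [← sum_filter, sum_const, nsmul_eq_mul]
        have h0 : 0 ≤ μ.real {R} := MeasureTheory.measureReal_nonneg
        split_ifs with h
        · have h' : 1 / 2 ≤ (#{i | P R i} : ℝ) * c := h
          nlinarith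
        · positivity
    _ = 2 * c * ∑ i, μ.real {R | P R i} := by
        rw [← mul_sum, sum_comm]
        congr 1
        refine sum_congr rfl fun i _ => ?_
        rw [real_eq_sum_singleton]
        rfl
    _ ≤ 2 * c * ∑ _i : ι, q := by
        gcongr with i
        exact hq i
    _ = _ := by simp

end Random

/-! ### Estimates -/

section Estimates

lemma choose_le_pow (n j : ℕ) (hj : 1 ≤ j) : (n.choose j : ℝ) ≤ (3 * n / j) ^ j := by
  have hj0 : (0 : ℝ) < j := by exact_mod_cast hj
  have h1 : (j : ℝ) ^ j / j.factorial ≤ 3 ^ j := by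
    refine (Real.pow_div_factorial_le_exp j hj0.le j).trans ?_
    calc Real.exp j = Real.exp 1 ^ j := by rw [← Real.exp_nat_mul, mul_one]
      _ ≤ 3 ^ j := by
        gcongr
        exact Real.exp_one_lt_three.le
  calc (n.choose j : ℝ) ≤ (n : ℝ) ^ j / j.factorial := Nat.choose_le_pow_div j n
    _ = (n / j) ^ j * ((j : ℝ) ^ j / j.factorial) := by
      rw [div_pow]
      field_simp
    _ ≤ (n / j) ^ j * 3 ^ j := by gcongr
    _ = _ := by
      rw [← mul_pow]
      congr 1
      ring

lemma sum_pow_quarter_le (k : ℕ) : ∑ j ∈ Icc 1 k, (1 / 4 : ℝ) ^ j ≤ 1 / 2 := by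
  suffices h : ∑ j ∈ Icc 1 k, (1 / 4 : ℝ) ^ j ≤ 1 / 2 - 1 / 2 * (1 / 4) ^ k by
    have : (0 : ℝ) < (1 / 4) ^ k := by positivity
    linarith
  induction k with
  | zero => simp
  | succ k ih =>
    rw [sum_Icc_succ_top (by omega), pow_succ]
    have : (0 : ℝ) < (1 / 4) ^ k := by positivity
    linarith

/-- The random choice of six edges per vertex expands: the expected number of narrow pairs is at
most `1 / 2`. -/
lemma sum_narrowPairs_le {V : Type*} [Fintype V] [DecidableEq V] {d k : ℕ} {a : ℝ} (ha : 0 < a)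
    (hV : 0 < Fintype.card V) (hd : a * Fintype.card V ≤ d)
    (hk : (k : ℝ) ≤ (a / 4) ^ 6 / 4 * Fintype.card V) :
    ∑ P ∈ narrowPairs V k, ((#P.2 : ℝ) / d) ^ (6 * #P.1) ≤ 1 / 2 := by
  set n := Fintype.card V
  have hn : (0 : ℝ) < n := by exact_mod_cast hV
  have hd0 : (0 : ℝ) < d := lt_of_lt_of_le (by positivity) hd
  have hmaps : ∀ P ∈ narrowPairs V k, #P.1 ∈ Icc 1 k := by
    intro P hP
    simp only [narrowPairs, mem_filter, mem_univ, true_and] at hP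
    exact mem_Icc.2 ⟨card_pos.2 hP.1, hP.2.1⟩
  rw [← sum_fiberwise_of_maps_to hmaps]
  refine le_trans (sum_le_sum fun j hj => ?_) (sum_pow_quarter_le k)
  obtain ⟨hj1, hjk⟩ := mem_Icc.1 hj
  have hj0 : (0 : ℝ) < j := by exact_mod_cast hj1
  have hjk' : (j : ℝ) ≤ k := by exact_mod_cast hjk
  have hfib : #{P ∈ narrowPairs V k | #P.1 = j} ≤ n.choose j * n.choose (4 * j) := by
    rw [show n = #(univ : Finset V) from card_univ.symm, ← card_powersetCard, ← card_powersetCard,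
      ← card_product]
    refine card_le_card fun P hP => ?_
    simp only [narrowPairs, mem_filter, mem_univ, true_and] at hP
    simp only [mem_product, mem_powersetCard, subset_univ, true_and]
    exact ⟨hP.2, by rw [hP.1.2.2, hP.2]⟩
  calc ∑ P ∈ narrowPairs V k with #P.1 = j, ((#P.2 : ℝ) / d) ^ (6 * #P.1)
      = ∑ P ∈ narrowPairs V k with #P.1 = j, (4 * (j : ℝ) / d) ^ (6 * j) := by
        refine sum_congr rfl fun P hP => ?_
        simp only [narrowPairs, mem_filter, mem_univ, true_and] at hP
        rw [hP.1.2.2, hP.2]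
        push_cast
        rfl
    _ = #{P ∈ narrowPairs V k | #P.1 = j} * (4 * (j : ℝ) / d) ^ (6 * j) := by
        rw [sum_const, nsmul_eq_mul]
    _ ≤ (n.choose j * n.choose (4 * j)) * (4 * (j : ℝ) / (a * n)) ^ (6 * j) := by
        gcongr
        exact_mod_cast hfib
    _ ≤ ((3 * n / j) ^ j * (3 * n / (4 * j : ℕ)) ^ (4 * j)) *
          (4 * (j : ℝ) / (a * n)) ^ (6 * j) := by
        gcongr
        · exact choose_le_pow n j hj1
        · exact choose_le_pow n (4 * j) (by omega)
    _ = (243 / 256 * ((4 / a) ^ 6 * (j / n))) ^ j := by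
        rw [pow_mul, pow_mul, ← mul_pow, ← mul_pow]
        congr 1
        push_cast
        field_simp
        norm_num
    _ ≤ (1 / 4) ^ j := by
        gcongr
        have h1 : (4 / a) ^ 6 * (j / n) ≤ 1 / 4 := by
          calc (4 / a) ^ 6 * (j / n) ≤ (4 / a) ^ 6 * ((a / 4) ^ 6 / 4 * n / n) := by
                gcongr
                exact hjk'.trans hk
            _ = 1 / 4 := by field_simp
        have h2 : 0 ≤ (4 / a) ^ 6 * (j / n) := by positivity
        linarith

/-- The bound on the failure probability: its factor `exp (-(L * (b * n)))` absorbs the entropy of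
the choices of edges, the number of claimed edges and the entropy of the added boosters. -/
lemma failure_bound_le {α ρ L x : ℝ} (hα : 0 < α) (hρ : 0 < ρ) (hL : L = 24 / α + 16 + 1 / ρ)
    {n b d : ℕ} (hn : 1 ≤ n) (hb : 1 ≤ b) (hd : α / 4 * n ≤ d) (hx : x ≤ -(L * (b * n))) :
    2 * (1 / d : ℝ) ^ (n * 6) * ((n : ℝ) ^ (n * 6) *
      (2 ^ (b + (b + 1) * (n * 6) + (b + 1) * n) * (1 / ρ) ^ n * Real.exp x)) ≤
        2 * Real.exp (-n) := by
  have hn0 : (0 : ℝ) < n := by exact_mod_cast hn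
  have hb1 : (1 : ℝ) ≤ b := by exact_mod_cast hb
  have hd0 : (0 : ℝ) < d := lt_of_lt_of_le (by positivity) hd
  have hbn1 : (n : ℝ) ≤ b * n := le_mul_of_one_le_left hn0.le hb1
  have hnb1 : (b : ℝ) ≤ b * n := le_mul_of_one_le_right (by positivity) (by exact_mod_cast hn)
  have hpow : ∀ y : ℝ, 0 ≤ y → y ^ n ≤ Real.exp (y * (b * n)) := by
    intro y hy
    calc y ^ n ≤ Real.exp y ^ n := by
          gcongr
          linarith [Real.add_one_le_exp y]
      _ = Real.exp (y * n) := by rw [← Real.exp_nat_mul, mul_comm]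
      _ ≤ _ := by gcongr
  have hchoices : (1 / d : ℝ) ^ (n * 6) * (n : ℝ) ^ (n * 6) ≤ Real.exp (24 / α * (b * n)) := by
    calc (1 / d : ℝ) ^ (n * 6) * (n : ℝ) ^ (n * 6) = (((n : ℝ) / d) ^ n) ^ 6 := by
          rw [← mul_pow, ← pow_mul]
          congr 1
          ring
      _ ≤ ((4 / α) ^ n) ^ 6 := by
          gcongr (?_ ^ n) ^ 6
          rw [div_le_div_iff₀ hd0 hα]
          linarith
      _ ≤ Real.exp (4 / α * (b * n)) ^ 6 := by
          gcongr
          exact hpow _ (by positivity)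
      _ = _ := by
          rw [← Real.exp_nat_mul]
          congr 1
          push_cast
          ring
  have hclaimed : (2 : ℝ) ^ (b + (b + 1) * (n * 6) + (b + 1) * n) ≤ Real.exp (15 * (b * n)) := by
    calc (2 : ℝ) ^ (b + (b + 1) * (n * 6) + (b + 1) * n)
        ≤ Real.exp 1 ^ (b + (b + 1) * (n * 6) + (b + 1) * n) := by
          gcongr
          linarith [Real.add_one_le_exp (1 : ℝ)]
      _ = Real.exp ((b + (b + 1) * (n * 6) + (b + 1) * n : ℕ) : ℝ) := by
          rw [← Real.exp_nat_mul, mul_one]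
      _ ≤ _ := by
          rw [Real.exp_le_exp]
          push_cast
          linarith
  calc _ = 2 * ((1 / d : ℝ) ^ (n * 6) * (n : ℝ) ^ (n * 6) *
        (2 ^ (b + (b + 1) * (n * 6) + (b + 1) * n) * (1 / ρ) ^ n * Real.exp x)) := by ring
    _ ≤ 2 * (Real.exp (24 / α * (b * n)) * (Real.exp (15 * (b * n)) *
        Real.exp (1 / ρ * (b * n)) * Real.exp (-(L * (b * n))))) := by
        gcongr
        exact hpow _ (by positivity)
    _ = 2 * Real.exp (-(b * n)) := by
        rw [← Real.exp_add, ← Real.exp_add, ← Real.exp_add, hL]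
        congr 2
        ring
    _ ≤ 2 * Real.exp (-n) := by gcongr

end Estimates
end MBHam

open MBHam Finset

theorem theorem1p2 (α : ℝ) (hα : 0 < α) :
    ∃ c C : ℝ, 0 < c ∧ 0 < C ∧
      ∀ ε : ℝ, 0 < ε → ∃ n₀ : ℕ, ∀ n : ℕ, n₀ ≤ n →
        ∀ (Gα : SimpleGraph (Fin n)) [DecidableRel Gα.Adj], α * (n : ℝ) ≤ (Gα.minDegree : ℝ) →
          ∀ b : ℕ, 1 ≤ b → (b : ℝ) ≤ c * (n : ℝ) / Real.log (n : ℝ) →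
            ∀ p : unitInterval, C * (b : ℝ) / (n : ℝ) ≤ (p : ℝ) →
              1 - ε ≤ (SimpleGraph.binomialRandom (Fin n) p).real
                {H : SimpleGraph (Fin n) | MakerWinsHamiltonicity b (Gα ⊔ H)} := by
  classical
  -- Sets of up to `κ * n` vertices will expand, which leaves about `(κ * n) ^ 2 / 2` boosters.
  obtain ⟨κ, hκ0, hκ1, hκ⟩ : ∃ κ : ℝ, 0 < κ ∧ κ ≤ 1 / 4 ∧ κ ≤ (α / 4 / 4) ^ 6 / 4 :=
    ⟨min (1 / 4) ((α / 4 / 4) ^ 6 / 4), by positivity, min_le_left _ _, min_le_right _ _⟩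
  set ρ : ℝ := κ ^ 2 / 8 with hρ
  have hρ0 : 0 < ρ := by positivity
  have hρ1 : ρ ≤ 1 := by nlinarith
  set L : ℝ := 24 / α + 16 + 1 / ρ with hL
  have hL0 : 0 < L := by positivity
  refine ⟨α / 100, L / ρ, by positivity, by positivity, fun ε hε => ?_⟩
  refine ⟨⌈4 / α⌉₊ + ⌈1 / κ⌉₊ + ⌈2 / ε⌉₊ + 12, fun n hn Gα _ hdeg b hb hbn p hp => ?_⟩
  have hn12 : (12 : ℝ) ≤ n := by exact_mod_cast (by omega : 12 ≤ n)
  have hnα : 4 / α ≤ n := (Nat.le_ceil _).trans (by exact_mod_cast (by omega))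
  have hnκ : 1 / κ ≤ n := (Nat.le_ceil _).trans (by exact_mod_cast (by omega))
  have hnε : 2 / ε ≤ n := (Nat.le_ceil _).trans (by exact_mod_cast (by omega))
  rw [div_le_iff₀ (by positivity)] at hnα hnκ hnε
  have hn0 : (0 : ℝ) < n := by linarith
  have hb1 : (1 : ℝ) ≤ b := by exact_mod_cast hb
  have hp0 : (0 : ℝ) ≤ p := p.2.1
  -- Breaker may take half of the `α * n` edges at a vertex, which leaves `d` choices for Maker.
  set d : ℕ := ⌊α * n / 2⌋₊ with hd
  set k : ℕ := ⌊κ * n⌋₊ with hk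
  have hd1 : (d : ℝ) ≤ α * n / 2 := Nat.floor_le (by positivity)
  have hd2 : α * n / 2 < d + 1 := Nat.lt_floor_add_one _
  have hd3 : α / 4 * n ≤ d := by linarith
  have hk1 : (k : ℝ) ≤ κ * n := Nat.floor_le (by positivity)
  have hk2 : κ * n < k + 1 := Nat.lt_floor_add_one _
  have hd0 : 1 ≤ d := Nat.le_floor (by push_cast; linarith)
  have hk0 : 1 ≤ k := Nat.le_floor (by push_cast; linarith)
  set T : ℕ := b + (b + 1) * (Fintype.card (Fin n) * 6) + (b + 1) * Fintype.card (Fin n) with hT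
  set c : ℝ := (1 / d) ^ (Fintype.card (Fin n) * 6) with hc
  have hlogn : 0 < Real.log n := Real.log_pos (by linarith)
  have hlog : 4 * b * (6 : ℕ) * Real.log (2 * Fintype.card (Fin n) * (6 : ℕ)) < d + 1 := by
    have h1 : Real.log (2 * Fintype.card (Fin n) * (6 : ℕ)) ≤ 2 * Real.log n := by
      rw [← Real.log_rpow hn0 2, Fintype.card_fin]
      refine Real.log_le_log (by positivity) ?_
      push_cast
      rw [Real.rpow_two]
      nlinarith
    rw [le_div_iff₀ hlogn] at hbn
    calc 4 * b * (6 : ℕ) * Real.log (2 * Fintype.card (Fin n) * (6 : ℕ))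
        ≤ 4 * b * (6 : ℕ) * (2 * Real.log n) := by gcongr
      _ = 48 * (b * Real.log n) := by push_cast; ring
      _ ≤ 48 * (α / 100 * n) := by gcongr
      _ < d + 1 := by
        have : 0 < α * n := by positivity
        linarith
  have hgood : ∀ R : SimpleGraph (Fin n), ¬ MakerWinsHamiltonicity b (Gα ⊔ R) →
      1 / 2 ≤ (#{f : Fin n × Fin 6 → Fin n | IsBad k T R f} : ℝ) * c := by
    intro R hR
    by_contra! hlt
    refine hR (makerWinsHamiltonicity_of_sum_lt (D := 6) (d := d) (k := k) ?_ hb (by norm_num) hd0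
      (fun v => ?_) ?_ hlog ?_ hlt)
    · rw [Fintype.card_fin]
      omega
    · have h1 : (2 * d : ℝ) ≤ Gα.minDegree := by linarith
      have h2 : 2 * d ≤ Gα.minDegree := by exact_mod_cast h1
      have h3 := h2.trans (Gα.minDegree_le_degree v)
      exact h3.trans_eq (by unfold SimpleGraph.degree; congr!)
    · rw [Fintype.card_fin]
      have : (4 * k : ℝ) ≤ n := by nlinarith
      exact_mod_cast this
    · refine sum_narrowPairs_le (a := α / 4) (by positivity)
        (by rw [Fintype.card_fin]; omega) ?_ ?_
      · rwa [Fintype.card_fin]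
      · rw [Fintype.card_fin]
        exact hk1.trans (by gcongr)
  have hmarkov := real_le_card_le (SimpleGraph.binomialRandom (Fin n) p)
    (fun R (f : Fin n × Fin 6 → Fin n) => IsBad k T R f) (c := c) (by positivity)
    (fun f => real_isBad_le p hk0 (by rw [Fintype.card_fin]; omega) f hρ0 hρ1)
  -- The choice of `ρ` lets the boosters outweigh the `ρ * p * n ^ 2` of their completions.
  have hexp : ρ * p * n ^ 2 - p * (k + 1) ^ 2 / 4 ≤ -(L * (b * n)) := by
    have h1 : (κ * n) ^ 2 ≤ ((k : ℝ) + 1) ^ 2 := by gcongr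
    have h2 : (p : ℝ) * (κ * n) ^ 2 ≤ p * ((k : ℝ) + 1) ^ 2 := by gcongr
    have h3 : L / ρ * b / n * (ρ * n ^ 2) ≤ p * (ρ * n ^ 2) := by gcongr
    have h4 : L / ρ * b / n * (ρ * n ^ 2) = L * (b * n) := by field_simp
    have h5 : (p : ℝ) * (κ * n) ^ 2 = 8 * (p * (ρ * n ^ 2)) := by rw [hρ]; ring
    linarith
  have hsmall : (SimpleGraph.binomialRandom (Fin n) p).real
      {R | 1 / 2 ≤ (#{f : Fin n × Fin 6 → Fin n | IsBad k T R f} : ℝ) * c} ≤ ε := by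
    refine hmarkov.trans ?_
    have hcard : (Fintype.card (Fin n × Fin 6 → Fin n) : ℝ) = (n : ℝ) ^ (n * 6) := by simp
    rw [hcard, hc, hT, Fintype.card_fin]
    refine (failure_bound_le hα hρ0 hL (by omega) hb hd3 hexp).trans ?_
    rw [Real.exp_neg, ← div_eq_mul_inv, div_le_iff₀ (Real.exp_pos _)]
    calc 2 ≤ n * ε := hnε
      _ ≤ Real.exp n * ε := by
        gcongr
        linarith [Real.add_one_le_exp (n : ℝ)]
      _ = _ := mul_comm _ _
  have hcover : (Set.univ : Set (SimpleGraph (Fin n))) ⊆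
      {H | MakerWinsHamiltonicity b (Gα ⊔ H)} ∪
        {R | 1 / 2 ≤ (#{f : Fin n × Fin 6 → Fin n | IsBad k T R f} : ℝ) * c} := by
    intro R _
    by_cases hR : MakerWinsHamiltonicity b (Gα ⊔ R)
    · exact Or.inl hR
    · exact Or.inr (hgood R hR)
  have hone : (SimpleGraph.binomialRandom (Fin n) p).real Set.univ = 1 :=
    MeasureTheory.probReal_univ
  have := MeasureTheory.measureReal_mono (μ := SimpleGraph.binomialRandom (Fin n) p) hcover
    (MeasureTheory.measure_ne_top _ _)
  have := MeasureTheory.measureReal_union_le (μ := SimpleGraph.binomialRandom (Fin n) p)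
    {H | MakerWinsHamiltonicity b (Gα ⊔ H)}
    {R | 1 / 2 ≤ (#{f : Fin n × Fin 6 → Fin n | IsBad k T R f} : ℝ) * c}
  linarith
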